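/- Let $r\ge 1$, let $\boldsymbol n=(n_1,\dots,n_r)$ and $\boldsymbol d=(d_1,\dots,d_r)$ be $r$-tuples of positive integers, and put $d=d_1+\dots+d_r$. Over $\mathbb C$, let $SV^{\boldsymbol n}_{\boldsymbol d}\subset\mathbb P^N$, $N=\prod_{i=1}^r\binom{n_i+d_i}{n_i}-1$, be the Segre--Veronese variety, i.e. $\mathbb P^{n_1}\times\dots\times\mathbb P^{n_r}$ embedded by the complete linear system $|\mathcal O(d_1,\dots,d_r)|$. For a projective variety $X\subset\mathbb P^N$, a smooth point $p\in X$ and $m\ge 0$, let $T^m_pX\subset\mathbb P^N$ be the $m$-osculating space: if $\phi$ is a local holomorphic parametrization of $X$ at $p=\phi(0)$ in an affine chart $\mathbb C^N\subset\mathbb P^N$, then $T^m_pX$ is the projective closure of the affine subspace through $p$ spanned by all partial derivatives of $\phi$ of order $\le m$ at $0$. One says that $X$ has \emph{strong $2$-osculating regularity} if for general points $p,q\in X$ (that is, for all $(p,q)$ in a non-empty Zariski open subset of $X\times X$) and all integers $k_1,k_2\ge 0$ there are a smooth curve $C$, a morphism $\gamma:C\to X$ and points $t_0,t_\infty\in C$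 with $\gamma(t_0)=p$, $\gamma(t_\infty)=q$, such that the flat limit, as $t\to t_0$ (in the Grassmannian), of the linear spaces $$T_t=\left\langle T^{k_1}_pX,\;T^{k_2}_{\gamma(t)}X\right\rangle,\qquad t\in C\setminus\{t_0\},$$ exists and is contained in $T^{k_1+k_2+1}_pX$. Then $SV^{\boldsymbol n}_{\boldsymbol d}$ has strong $2$-osculating regularity. More precisely, for general points $p,q\in X=SV^{\boldsymbol n}_{\boldsymbol d}$ and all $k_1,k_2\ge 0$, there are a parametrized rational normal curve $\gamma:\mathbb P^1\to X$ of degree $d$ (that is, $[s:t]\mapsto[\sum_{l=0}^d s^{d-l}t^l a_l]$ with $a_0,\dots,a_d$ linearly independent) and points $t_0,t_\infty\in\mathbb P^1$ with $\gamma(t_0)=p$ and $\gamma(t_\infty)=q$, such that the flat limit as $t\to t_0$ of $\left\langle T^{k_1}_pX,T^{k_2}_{\gamma(t)}X\right\rangle$ exists and is contained in $T^{k_1+k_2+1}_pX$. -/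

import Mathlib

open Filter Topology
open scoped LinearAlgebra.Projectivization

/-! ### Projective spaces, Zariski closed sets, local parametrizations -/

/-- The classical (quotient) topology on a complex projective space. -/
noncomputable instance projectivizationTopology {V : Type*} [AddCommGroup V] [Module ℂ V] [TopologicalSpace V] :
    TopologicalSpace (ℙ ℂ V) :=
  TopologicalSpace.coinduced (Projectivization.mk' ℂ) inferInstance

/-- Zero loci of families of homogeneous polynomials. -/
def IsZariskiClosed {ι : Type} (Z : Set (ℙ ℂ (ι → ℂ))) : Prop :=
  ∃ S : Set (MvPolynomial ι ℂ), (∀ F ∈ S, ∃ k : ℕ, F.IsHomogeneous k) ∧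
    Z = {x | ∀ F ∈ S, MvPolynomial.eval x.rep F = 0}

/-- The part of `X` in the standard affine chart `z_i ≠ 0`, which is identified with the affine
hyperplane `z_i = 1` of the vector space `ι → ℂ`. -/
def affinePart {ι : Type} (X : Set (ℙ ℂ (ι → ℂ))) (i : ι) : Set (ι → ℂ) :=
  {v | v i = 1 ∧ ∃ h : v ≠ 0, Projectivization.mk ℂ v h ∈ X}

/-- `φ` is (the germ at `0` of) a local parametrization of `X` at `p`, written in the standard
affine chart `z_i = 1`: a holomorphic immersion with `0 ↦ p` which maps the neighbourhoods of `0`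
in `ℂⁿ` onto the neighbourhoods of `p` in `X`. Such a `φ` exists for some `i` if and only if `X`
is, near `p`, a complex submanifold of dimension `n` (for a projective variety of dimension `n`:
if and only if `p` is a smooth point). -/
structure IsLocalParametrization {ι : Type} [Fintype ι] {n : ℕ} (X : Set (ℙ ℂ (ι → ℂ)))
    (p : ℙ ℂ (ι → ℂ)) (i : ι) (φ : (Fin n → ℂ) → (ι → ℂ)) : Prop where
  analyticAt : AnalyticAt ℂ φ 0
  map_zero : φ 0 ∈ affinePart {p} i
  immersion : Function.Injective (fderiv ℂ φ 0)
  map_nhds : Filter.map φ (𝓝 0) = 𝓝[affinePart X i] (φ 0)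

/-- The `m`-osculating space of `X` at `p`, as a linear subspace of `ι → ℂ` (the affine cone over
the projective subspace): it is spanned by the partial derivatives `∂^k φ / ∂t_{s 0} ⋯ ∂t_{s (k-1)}`
at `0`, of order `k ≤ m`, of a local parametrization `φ` of `X` at `p`.
In the chart `z_i = 1` the derivative of order `0` is the vector `φ 0` over `p`, and the others lie
in the hyperplane `z_i = 0` of directions, so that this is the cone over the projective closure of
the affine subspace through `p` spanned by the derivatives. The span does not depend on the local
parametrization, so all of them are used at once. -/
def osculatingSpace {ι : Type} [Fintype ι] (X : Set (ℙ ℂ (ι → ℂ))) (p : ℙ ℂ (ι → ℂ)) (m : ℕ) :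
    Submodule ℂ (ι → ℂ) :=
  Submodule.span ℂ {w | ∃ (n : ℕ) (i : ι) (φ : (Fin n → ℂ) → (ι → ℂ)),
    IsLocalParametrization X p i φ ∧ ∃ k ≤ m, ∃ s : Fin k → Fin n,
      w = iteratedFDeriv ℂ k φ 0 (fun a => Pi.single (s a) 1)}

/-! ### Curves, morphisms and flat limits -/

/-- A smooth (irreducible, quasi-projective) curve in `ℙ^M`. -/
structure IsSmoothCurve {M : ℕ} (C : Set (ℙ ℂ (Fin (M + 1) → ℂ))) : Prop where
  nonempty : C.Nonempty
  locallyClosed : ∃ Z Z' : Set (ℙ ℂ (Fin (M + 1) → ℂ)),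
    IsZariskiClosed Z ∧ IsZariskiClosed Z' ∧ C = Z \ Z'
  irreducible : ∀ Z Z' : Set (ℙ ℂ (Fin (M + 1) → ℂ)),
    IsZariskiClosed Z → IsZariskiClosed Z' → C ⊆ Z ∪ Z' → C ⊆ Z ∨ C ⊆ Z'
  smooth : ∀ x ∈ C, ∃ (i : Fin (M + 1)) (φ : (Fin 1 → ℂ) → (Fin (M + 1) → ℂ)),
    IsLocalParametrization C x i φ

/-- `γ` is a morphism on the irreducible quasi-projective set `C`: near every point of `C` it is
given by homogeneous polynomials of one degree without common zero at that point. -/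
def IsMorphismOn {M : ℕ} {ι : Type} (C : Set (ℙ ℂ (Fin (M + 1) → ℂ)))
    (γ : ℙ ℂ (Fin (M + 1) → ℂ) → ℙ ℂ (ι → ℂ)) : Prop :=
  ∀ x ∈ C, ∃ (k : ℕ) (F : ι → MvPolynomial (Fin (M + 1)) ℂ),
    (∀ i, (F i).IsHomogeneous k) ∧
    (fun i => MvPolynomial.eval x.rep (F i)) ≠ 0 ∧
    ∀ y ∈ C, ∀ h : (fun i => MvPolynomial.eval y.rep (F i)) ≠ 0,
      γ y = Projectivization.mk ℂ (fun i => MvPolynomial.eval y.rep (F i)) h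

/-- A parametrized rational normal curve of degree `e`:
`[s : t] ↦ [s^e a_0 + s^(e-1) t a_1 + ⋯ + t^e a_e]` with `a_0, …, a_e` linearly independent. -/
def IsRationalNormalCurve {ι : Type} (e : ℕ) (γ : ℙ ℂ (Fin 2 → ℂ) → ℙ ℂ (ι → ℂ)) : Prop :=
  ∃ a : Fin (e + 1) → (ι → ℂ), LinearIndependent ℂ a ∧
    ∀ (v : Fin 2 → ℂ) (hv : v ≠ 0),
      ∃ h : ∑ l : Fin (e + 1), (v 0 ^ (e - (l : ℕ)) * v 1 ^ (l : ℕ)) • a l ≠ 0,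
        γ (Projectivization.mk ℂ v hv) = Projectivization.mk ℂ _ h

/-- `T₀` is the limit along `l` of the linear subspaces `T t` in the Grassmannian: near the limit
they have the dimension `m` of `T₀`, and they have bases which converge to a basis of `T₀`. -/
def IsFlatLimit {ι B : Type} (T : B → Submodule ℂ (ι → ℂ)) (l : Filter B)
    (T₀ : Submodule ℂ (ι → ℂ)) : Prop :=
  ∃ (m : ℕ) (b : B → Fin m → (ι → ℂ)) (b₀ : Fin m → (ι → ℂ)),
    (∀ᶠ t in l, LinearIndependent ℂ (b t) ∧ Submodule.span ℂ (Set.range (b t)) = T t) ∧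
    LinearIndependent ℂ b₀ ∧ Submodule.span ℂ (Set.range b₀) = T₀ ∧
    Tendsto b l (𝓝 b₀)

/-- For the curve `γ : C → X`, the linear spaces `⟨T^{k₁}_p X, T^{k₂}_{γ t} X⟩`, `t ∈ C \ {t₀}`, have
a flat limit as `t → t₀`, and it is contained in `T^{k₁+k₂+1}_p X`. -/
def LimitInOsculatingSpace {ι : Type} [Fintype ι] {M : ℕ} (X : Set (ℙ ℂ (ι → ℂ)))
    (p : ℙ ℂ (ι → ℂ)) (k₁ k₂ : ℕ) (C : Set (ℙ ℂ (Fin (M + 1) → ℂ)))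
    (γ : ℙ ℂ (Fin (M + 1) → ℂ) → ℙ ℂ (ι → ℂ)) (t₀ : ℙ ℂ (Fin (M + 1) → ℂ)) : Prop :=
  ∃ T₀ : Submodule ℂ (ι → ℂ),
    IsFlatLimit (fun t => osculatingSpace X p k₁ ⊔ osculatingSpace X (γ t) k₂)
      (𝓝[C \ {t₀}] t₀) T₀ ∧
    T₀ ≤ osculatingSpace X p (k₁ + k₂ + 1)

/-! ### General points and strong 2-osculating regularity -/

/-- `P p q` holds for general points `p, q` of the (irreducible) variety `X`, that is, for all
`(p, q)` in some non-empty Zariski open subset of `X × X`: there is a polynomial in the coordinates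
of two vectors, not vanishing identically on pairs of vectors over `X`, such that `P` holds
wherever it does not vanish. (The condition is imposed for all vectors over `p` and `q`, so the
polynomial need not be bihomogeneous: one can pass to its bihomogeneous components.) -/
def ForGeneralPair {ι : Type} (X : Set (ℙ ℂ (ι → ℂ)))
    (P : ℙ ℂ (ι → ℂ) → ℙ ℂ (ι → ℂ) → Prop) : Prop :=
  ∃ F : MvPolynomial (ι ⊕ ι) ℂ,
    (∃ (v w : ι → ℂ) (hv : v ≠ 0) (hw : w ≠ 0), Projectivization.mk ℂ v hv ∈ X ∧
      Projectivization.mk ℂ w hw ∈ X ∧ MvPolynomial.eval (Sum.elim v w) F ≠ 0) ∧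
    ∀ (v w : ι → ℂ) (hv : v ≠ 0) (hw : w ≠ 0), Projectivization.mk ℂ v hv ∈ X →
      Projectivization.mk ℂ w hw ∈ X → MvPolynomial.eval (Sum.elim v w) F ≠ 0 →
      P (Projectivization.mk ℂ v hv) (Projectivization.mk ℂ w hw)

/-- Strong 2-osculating regularity of a projective variety `X`. -/
def HasStrongTwoOsculatingRegularity {ι : Type} [Fintype ι] (X : Set (ℙ ℂ (ι → ℂ))) : Prop :=
  ForGeneralPair X fun p q => ∀ k₁ k₂ : ℕ,
    ∃ (M : ℕ) (C : Set (ℙ ℂ (Fin (M + 1) → ℂ)))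
      (γ : ℙ ℂ (Fin (M + 1) → ℂ) → ℙ ℂ (ι → ℂ)),
      IsSmoothCurve C ∧ IsMorphismOn C γ ∧ Set.MapsTo γ C X ∧
      ∃ t₀ ∈ C, ∃ t₁ ∈ C, γ t₀ = p ∧ γ t₁ = q ∧ LimitInOsculatingSpace X p k₁ k₂ C γ t₀

/-! ### Segre-Veronese varieties -/

/-- Index set of the monomials of multidegree `(d_1, …, d_r)` in `r` groups of variables, the
`j`-th group being `x_0, …, x_{n_j}`: a multiset of `d_j` indices for every `j`. -/
abbrev MonomialIndex {r : ℕ} (n d : Fin r → ℕ) : Type :=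
  (j : Fin r) → Sym (Fin (n j + 1)) (d j)

/-- The vector of all monomials of multidegree `d` in the coordinates of `v_1, …, v_r`. -/
def segreVeroneseVector {r : ℕ} (n d : Fin r → ℕ) (v : (j : Fin r) → Fin (n j + 1) → ℂ) :
    MonomialIndex n d → ℂ :=
  fun K => ∏ j, ((K j : Multiset (Fin (n j + 1))).map (v j)).prod

theorem segreVeroneseVector_ne_zero {r : ℕ} (n d : Fin r → ℕ)
    (v : (j : Fin r) → Fin (n j + 1) → ℂ) (hv : ∀ j, v j ≠ 0) :
    segreVeroneseVector n d v ≠ 0 := by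
  choose i hi using fun j => Function.ne_iff.mp (hv j)
  intro h
  have h1 := congrFun h (fun j => Sym.replicate (d j) (i j))
  simp only [segreVeroneseVector, Pi.zero_apply, Finset.prod_eq_zero_iff, Finset.mem_univ,
    true_and] at h1
  obtain ⟨j, hj⟩ := h1
  simp [Sym.coe_replicate] at hj
  exact hi j hj.1

/-- The Segre-Veronese variety: the image of `ℙ^{n_1} × ⋯ × ℙ^{n_r}` under the embedding by the
complete linear system `|𝒪(d_1, …, d_r)|`, in the basis of monomials. -/
def segreVeronese {r : ℕ} (n d : Fin r → ℕ) : Set (ℙ ℂ (MonomialIndex n d → ℂ)) :=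
  {x | ∃ (v : (j : Fin r) → Fin (n j + 1) → ℂ) (hv : ∀ j, v j ≠ 0),
    x = Projectivization.mk ℂ (segreVeroneseVector n d v) (segreVeroneseVector_ne_zero n d v hv)}

/-! ### Order of vanishing of analytic functions -/

/-! The product of the groups `GL(n_j + 1)` acts on all the data. A pair of points whose components
are distinct in every factor can therefore be moved to `p = (e_0, …, e_0)` and `q = ((0, 1, …, 1),
…)`, and such pairs are general (`forGeneralPair_segreVeroneseCurve`). The curve is then the image
of `t ↦ (1, t, …, t)` in every factor, for all `k₁`, `k₂` at once. For `t ≠ 0` its point is the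
image of the all-ones point under the torus element `diag(1, t, …, t)`. This element fixes `p` and
multiplies a monomial by `t` to the power of its weight, the number of its factors other than first
coordinates. So the moving space is the image under a diagonal one-parameter group of one fixed
space `W`, the span of `T^{k₁}` at `p` and `T^{k₂}` at the all-ones point. Its limit exists and is
spanned by lowest weight parts of a suitable basis of `W` (`exists_isFlatLimit_diagonalAction`).
Since `T^m` at `p` consists of the vectors supported in weights at most `m`, it remains to see that
an element of `W` vanishing in all weights up to `k₁ + k₂ + 1` is zero
(`eq_zero_of_mem_sup_osculatingSpace`). Above weight `k₁` only the summand from the all-ones point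
contributes. That summand satisfies a difference equation of order `k₂ + 1` in the weight, so its
vanishing in `k₂ + 1` consecutive weights propagates upwards. Osculating spaces are handled by
duality: a linear form kills `T^m` at the point over `v` exactly when its pullback to the affine
cone vanishes to order `m + 1` at `v` (`forall_osculatingSpace_eq_zero_iff`). Equivariance and all
explicit equations follow from this. -/

theorem HasFPowerSeriesAt.apply_diag_eq_zero_of_isBigO {E : Type*} [NormedAddCommGroup E]
    [NormedSpace ℂ E] {f : E → ℂ} {p : FormalMultilinearSeries ℂ E ℂ}
    (hp : HasFPowerSeriesAt f p 0) {m : ℕ} (h : f =O[𝓝 0] fun x => ‖x‖ ^ (m + 1)) :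
    ∀ k ≤ m, ∀ y, (p k fun _ => y) = 0 := by
  intro k
  induction k using Nat.strong_induction_on with
  | _ k ih =>
    intro hk y
    -- A form of degree `k` that is `O(‖x‖ ^ (k + 1))` is zero; by induction the lower Taylor terms
    -- are absent, so this form is `f` minus its Taylor remainder.
    refine Asymptotics.IsBigO.continuousMultilinearMap_apply_eq_zero ?_ y
    have h1 := hp.isBigO_sub_partialSum_pow (k + 1)
    have h2 : f =O[𝓝 0] fun x => ‖x‖ ^ (k + 1) :=
      h.trans (Asymptotics.IsBigO.of_bound 1 (by
        filter_upwards [Metric.closedBall_mem_nhds (0 : E) one_pos] with x hx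
        have hx' : ‖x‖ ≤ 1 := by simpa using hx
        simpa using pow_le_pow_of_le_one (norm_nonneg x) hx' (by omega : k + 1 ≤ m + 1)))
    have h3 := h2.sub h1
    refine h3.congr_left fun x => ?_
    simp only [zero_add, sub_sub_cancel, FormalMultilinearSeries.partialSum]
    rw [Finset.sum_range_succ, Finset.sum_eq_zero, zero_add]
    intro i hi
    rw [Finset.mem_range] at hi
    exact ih i hi (by omega) x

/-- Both conditions say that the Taylor terms of degree at most `m` vanish on the diagonal; by
polarization and multilinearity this is seen on coordinate vectors. -/
theorem AnalyticAt.isBigO_pow_iff_iteratedFDeriv_eq_zero {n : ℕ} {f : (Fin n → ℂ) → ℂ}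
    (hf : AnalyticAt ℂ f 0) (m : ℕ) :
    (f =O[𝓝 0] fun x => ‖x‖ ^ (m + 1)) ↔
      ∀ k ≤ m, ∀ s : Fin k → Fin n, iteratedFDeriv ℂ k f 0 (fun a => Pi.single (s a) 1) = 0 := by
  obtain ⟨p, hp⟩ := hf
  obtain ⟨R, hR⟩ := id hp
  constructor
  · intro h k hk s
    have h0 := hp.apply_diag_eq_zero_of_isBigO h k hk
    rw [hR.iteratedFDeriv_eq_sum_of_completeSpace]
    -- The sum over permutations giving the `k`-th derivative of `f` is also the `k`-th derivative
    -- of the diagonal function of `p k`, which is identically zero.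
    refine (ContinuousMultilinearMap.iteratedFDeriv_comp_diagonal (p k) 0
      fun a => Pi.single (s a) 1).symm.trans ?_
    have : (fun x : Fin n → ℂ => p k fun _ => x) = fun _ => 0 := funext h0
    rw [this, iteratedFDeriv_fun_zero]
    rfl
  · intro h
    have h0 : ∀ k ≤ m, iteratedFDeriv ℂ k f 0 = 0 := by
      intro k hk
      apply ContinuousMultilinearMap.toMultilinearMap_injective
      refine Module.Basis.ext_multilinear (fun _ => Pi.basisFun ℂ (Fin n)) fun v => ?_
      simpa using h k hk v
    have h1 := hp.isBigO_sub_partialSum_pow (m + 1)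
    refine h1.congr_left fun x => ?_
    rw [zero_add, FormalMultilinearSeries.partialSum, Finset.sum_eq_zero, sub_zero]
    intro k hk
    rw [Finset.mem_range] at hk
    have h2 := hR.factorial_smul x k
    rw [h0 k (by omega)] at h2
    simpa [Nat.factorial_ne_zero] using h2

/-- Write `p = X ^ e * q` with `q(0) ≠ 0`. If `e ≤ m`, dividing by `t ^ e` makes `q` tend to `0` at
the origin, which is absurd. -/
theorem Polynomial.coeff_eq_zero_of_isBigO {p : Polynomial ℂ} {m : ℕ}
    (h : (fun t : ℂ => p.eval t) =O[𝓝 0] fun t => ‖t‖ ^ (m + 1)) :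
    ∀ k ≤ m, p.coeff k = 0 := by
  by_contra! hc
  obtain ⟨k, hk, hpk⟩ := hc
  have hp : p ≠ 0 := by rintro rfl; simp at hpk
  obtain ⟨q, hq, hqd⟩ := Polynomial.exists_eq_pow_rootMultiplicity_mul_and_not_dvd p hp 0
  set e := p.rootMultiplicity 0
  rw [Polynomial.C_0, sub_zero] at hq hqd
  have he : e ≤ m := by
    by_contra! he
    apply hpk
    rw [hq, Polynomial.coeff_X_pow_mul', if_neg (by omega)]
  have hq0 : q.eval 0 ≠ 0 := by
    rwa [Polynomial.X_dvd_iff, Polynomial.coeff_zero_eq_eval_zero] at hqd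
  have h1 : (fun t : ℂ => q.eval t) =O[𝓝[≠] 0] fun t => ‖t‖ ^ (m + 1 - e) := by
    have h2 : (fun t : ℂ => t ^ e * q.eval t) =O[𝓝[≠] 0] fun t => t ^ e * (‖t‖ : ℂ) ^ (m + 1 - e) := by
      refine ((h.mono nhdsWithin_le_nhds).congr_left (fun t => ?_)).trans
        (Asymptotics.IsBigO.of_bound 1 (Eventually.of_forall fun t => ?_))
      · conv_lhs => rw [hq]
        simp
      · simp only [norm_mul, norm_pow, norm_norm, Complex.norm_real, one_mul]
        rw [← pow_add]
        congr! 1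
        omega
    have h3 : (fun t : ℂ => q.eval t) =O[𝓝[≠] 0] fun t => (‖t‖ : ℂ) ^ (m + 1 - e) := by
      refine (((Asymptotics.isBigO_refl (fun t : ℂ => (t ^ e)⁻¹) (𝓝[≠] 0)).mul h2).congr' ?_ ?_)
      all_goals
        filter_upwards [self_mem_nhdsWithin] with t ht
        have : t ≠ 0 := ht
        field_simp
    refine h3.trans (Asymptotics.IsBigO.of_bound 1 (Eventually.of_forall fun t => ?_))
    simp
  have h2 : Tendsto (fun t : ℂ => q.eval t) (𝓝[≠] 0) (𝓝 0) := by
    refine h1.trans_tendsto (tendsto_nhdsWithin_of_tendsto_nhds ?_)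
    have : Continuous fun t : ℂ => ‖t‖ ^ (m + 1 - e) := by fun_prop
    have := this.tendsto 0
    simpa [show m + 1 - e ≠ 0 by omega] using this
  have h3 : Tendsto (fun t : ℂ => q.eval t) (𝓝[≠] 0) (𝓝 (q.eval 0)) :=
    (q.continuous.tendsto 0).mono_left nhdsWithin_le_nhds
  exact hq0 (tendsto_nhds_unique h3 h2)

/-- An injective parametrization of the whole affine part with a differentiable left inverse is a
local parametrization. -/
theorem IsLocalParametrization.of_leftInverse {ι : Type} [Fintype ι] {n : ℕ}
    {X : Set (ℙ ℂ (ι → ℂ))} {p : ℙ ℂ (ι → ℂ)} {i : ι} {φ : (Fin n → ℂ) → (ι → ℂ)}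
    {ψ : (ι → ℂ) → (Fin n → ℂ)} (hφ : AnalyticOnNhd ℂ φ Set.univ) (hψ : Differentiable ℂ ψ)
    (hψφ : Function.LeftInverse ψ φ) (hrange : Set.range φ = affinePart X i)
    (h0 : φ 0 ∈ affinePart {p} i) : IsLocalParametrization X p i φ where
  analyticAt := hφ 0 trivial
  map_zero := h0
  immersion := by
    have h1 : HasFDerivAt (ψ ∘ φ) ((fderiv ℂ ψ (φ 0)).comp (fderiv ℂ φ 0)) 0 :=
      (hψ _).hasFDerivAt.comp 0 (hφ 0 trivial).differentiableAt.hasFDerivAt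
    rw [hψφ.comp_eq_id] at h1
    have h2 := h1.unique (hasFDerivAt_id 0)
    exact Function.LeftInverse.injective (g := fderiv ℂ ψ (φ 0)) fun x => DFunLike.congr_fun h2 x
  map_nhds := by
    rw [← hrange]
    refine Topology.IsInducing.map_nhds_eq ?_ 0
    refine Topology.IsInducing.of_comp (g := ψ) ?_ hψ.continuous ?_
    · exact continuousOn_univ.mp hφ.continuousOn
    · rw [hψφ.comp_eq_id]
      exact Topology.IsInducing.id

theorem LinearIndependent.exists_linearEquiv_pair {V : Type*} [AddCommGroup V] [Module ℂ V]
    [FiniteDimensional ℂ V] {a b a' b' : V} (h : LinearIndependent ℂ ![a, b])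
    (h' : LinearIndependent ℂ ![a', b']) : ∃ g : V ≃ₗ[ℂ] V, g a = a' ∧ g b = b' := by
  let f := h.linearCombinationEquiv.symm ≪≫ₗ h'.linearCombinationEquiv
  obtain ⟨g, hg⟩ := Submodule.exists_linearEquiv_restrict_eq f
  have q (i : Fin 2) {u : Fin 2 → V} (hu : LinearIndependent ℂ u) :
      (hu.linearCombinationEquiv (Finsupp.single i 1) : V) = u i := by simp
  refine ⟨g, ?_, ?_⟩
  · have h1 := hg (h.linearCombinationEquiv (Finsupp.single 0 1))
    rw [q] at h1
    simpa [f] using h1.symm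
  · have h1 := hg (h.linearCombinationEquiv (Finsupp.single 1 1))
    rw [q] at h1
    simpa [f] using h1.symm

/-! ### Limits under a diagonal one-parameter group -/

/-- The diagonal map with weights `e`. -/
def diagonalAction {ι : Type} (e : ι → ℕ) (t : ℂ) : (ι → ℂ) →ₗ[ℂ] (ι → ℂ) where
  toFun u K := t ^ e K * u K
  map_add' u v := by ext; simp [mul_add]
  map_smul' c u := by ext; simp; ring

@[simp] theorem diagonalAction_apply {ι : Type} (e : ι → ℕ) (t : ℂ) (u : ι → ℂ) (K : ι) :
    diagonalAction e t u K = t ^ e K * u K := rfl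

theorem diagonalAction_injective {ι : Type} (e : ι → ℕ) {t : ℂ} (ht : t ≠ 0) :
    Function.Injective (diagonalAction e t) := by
  intro u v h
  ext K
  have := congrFun h K
  simpa [ht] using this

/-- Every subspace has a basis whose lowest weight parts are linearly independent. -/
theorem Submodule.exists_basis_lowest_weight {ι : Type} [Fintype ι] (e : ι → ℕ) (m : ℕ) :
    ∀ W : Submodule ℂ (ι → ℂ), Module.finrank ℂ W = m →
    ∃ (b b₀ : Fin m → (ι → ℂ)) (ε : Fin m → ℕ), LinearIndependent ℂ b ∧
      Submodule.span ℂ (Set.range b) = W ∧ LinearIndependent ℂ b₀ ∧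
      (∀ i K, b i K ≠ 0 → ε i ≤ e K) ∧
      ∀ i K, b₀ i K = if e K = ε i then b i K else 0 := by
  classical
  induction m with
  | zero =>
    intro W hW
    refine ⟨Fin.elim0, Fin.elim0, Fin.elim0, linearIndependent_empty_type, ?_,
      linearIndependent_empty_type, fun i => i.elim0, fun i => i.elim0⟩
    rw [Submodule.finrank_eq_zero] at hW
    simp [hW, Set.range_eq_empty]
  | succ m ih =>
    intro W hW
    have hne : ∃ K, ∃ w ∈ W, w K ≠ 0 := by
      by_contra! h
      have : W = ⊥ := by
        rw [Submodule.eq_bot_iff]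
        intro w hw
        ext K
        exact h K w hw
      rw [this] at hW
      simp at hW
    -- Gaussian elimination ordered by weight: `s` has least weight among the coordinates not
    -- vanishing on `W`. The other basis vectors are taken in `W'`, where coordinate `s` vanishes,
    -- so their lowest parts cannot span that of `w`.
    obtain ⟨s, ⟨w, hw, hws⟩, hmin⟩ := exists_minimalFor_of_wellFoundedLT
      (fun K => ∃ w ∈ W, w K ≠ 0) e hne
    have hmin' : ∀ u ∈ W, ∀ K, u K ≠ 0 → e s ≤ e K := by
      intro u hu K hK
      rcases le_total (e s) (e K) with h | h
      · exact h
      · exact hmin ⟨u, hu, hK⟩ h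
    let π : (ι → ℂ) →ₗ[ℂ] ℂ := LinearMap.proj s
    let W' : Submodule ℂ (ι → ℂ) := W ⊓ LinearMap.ker π
    have hW' : ∀ u, u ∈ W' ↔ u ∈ W ∧ u s = 0 := fun u => by simp [W', π]
    have hspan : W' ⊔ Submodule.span ℂ {w} = W := by
      apply le_antisymm
      · refine sup_le inf_le_left ?_
        simpa using hw
      · intro u hu
        rw [Submodule.mem_sup]
        refine ⟨u - (u s / w s) • w, ?_, (u s / w s) • w, ?_, by simp⟩
        · rw [hW']
          refine ⟨W.sub_mem hu (W.smul_mem _ hw), ?_⟩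
          simp [hws]
        · exact Submodule.smul_mem _ _ (Submodule.mem_span_singleton_self w)
    have hdisj : Disjoint W' (Submodule.span ℂ {w}) := by
      rw [Submodule.disjoint_def]
      intro u hu hu2
      obtain ⟨c, rfl⟩ := Submodule.mem_span_singleton.mp hu2
      have := ((hW' _).mp hu).2
      simp only [Pi.smul_apply, smul_eq_mul, mul_eq_zero, hws, or_false] at this
      simp [this]
    have hrank : Module.finrank ℂ W' = m := by
      have h1 := Submodule.finrank_sup_add_finrank_inf_eq W' (Submodule.span ℂ {w})
      rw [hspan, hW, hdisj.eq_bot, finrank_bot, finrank_span_singleton] at h1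
      · omega
      · rintro rfl; exact hws rfl
    obtain ⟨b, b₀, ε, hb, hbW, hb₀, hε, hbb⟩ := ih W' hrank
    have hbmem : ∀ i, b i ∈ W' := fun i => hbW ▸ Submodule.subset_span ⟨i, rfl⟩
    refine ⟨Fin.cons w b, Fin.cons (fun K => if e K = e s then w K else 0) b₀, Fin.cons (e s) ε,
      ?_, ?_, ?_, ?_, ?_⟩
    · rw [linearIndependent_finCons]
      refine ⟨hb, ?_⟩
      rw [hbW, hW']
      exact fun h => hws h.2
    · rw [Fin.range_cons, Submodule.span_insert, hbW, sup_comm, hspan]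
    · rw [linearIndependent_finCons]
      refine ⟨hb₀, fun h => hws ?_⟩
      have hle : Submodule.span ℂ (Set.range b₀) ≤ LinearMap.ker π := by
        rw [Submodule.span_le]
        rintro _ ⟨i, rfl⟩
        have := ((hW' _).mp (hbmem i)).2
        simp [π, hbb, this]
      simpa [π] using hle h
    · intro i K
      refine Fin.cases ?_ (fun i => ?_) i
      · exact hmin' w hw K
      · exact hε i K
    · intro i K
      refine Fin.cases ?_ (fun i => ?_) i
      · rfl
      · exact hbb i K

theorem Submodule.span_range_units_smul {ι V : Type*} [AddCommGroup V] [Module ℂ V] (v : ι → V)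
    (c : ι → ℂˣ) :
    Submodule.span ℂ (Set.range fun i => c i • v i) = Submodule.span ℂ (Set.range v) := by
  apply le_antisymm <;> rw [Submodule.span_le] <;> rintro _ ⟨i, rfl⟩
  · exact Submodule.smul_mem _ (c i : ℂ) (Submodule.subset_span ⟨i, rfl⟩)
  · have := Submodule.smul_mem _ ((c i)⁻¹ : ℂˣ).val (Submodule.subset_span (R := ℂ)
      (Set.mem_range_self (f := fun i => c i • v i) i))
    simpa [← Units.smul_def] using this

/-- Dividing the image of `b i` by `t ^ ε i` does not change the span and lets the vector converge
to its lowest weight part. Independence of these parts makes the limit flat, and `hW` bounds the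
lowest weights by `M`. -/
theorem exists_isFlatLimit_diagonalAction {ι : Type} [Fintype ι] (e : ι → ℕ)
    (W : Submodule ℂ (ι → ℂ)) (M : ℕ) (hW : ∀ w ∈ W, (∀ K, e K ≤ M → w K = 0) → w = 0) :
    ∃ T₀ : Submodule ℂ (ι → ℂ),
      IsFlatLimit (fun t => W.map (diagonalAction e t)) (𝓝[≠] 0) T₀ ∧
      ∀ u ∈ T₀, ∀ K, M < e K → u K = 0 := by
  obtain ⟨b, b₀, ε, hb, hbW, hb₀, hε, hbb⟩ := Submodule.exists_basis_lowest_weight e _ W rfl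
  -- The truncated subtraction `e K - ε i` is harmless: where it truncates, `b i K = 0`.
  refine ⟨Submodule.span ℂ (Set.range b₀), ⟨_, fun t i K => t ^ (e K - ε i) * b i K, b₀, ?_, hb₀, rfl,
    ?_⟩, ?_⟩
  · filter_upwards [self_mem_nhdsWithin] with t ht
    have ht : t ≠ 0 := ht
    have h1 : (fun i K => t ^ (e K - ε i) * b i K) = fun i =>
        ((Units.mk0 t ht) ^ (ε i))⁻¹ • diagonalAction e t (b i) := by
      ext i K
      simp only [Pi.smul_apply, diagonalAction_apply, Units.smul_def, smul_eq_mul]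
      by_cases hK : b i K = 0
      · simp [hK]
      · rw [pow_sub₀ _ ht (hε i K hK)]
        simp
        ring
    rw [h1]
    have h2 : LinearIndependent ℂ fun i => diagonalAction e t (b i) :=
      hb.map' (diagonalAction e t) (LinearMap.ker_eq_bot.mpr (diagonalAction_injective e ht))
    refine ⟨h2.units_smul _, ?_⟩
    refine (Submodule.span_range_units_smul _ _).trans ?_
    conv_rhs => rw [← hbW]
    rw [Submodule.map_span, ← Set.range_comp]
    rfl
  · rw [tendsto_pi_nhds]
    intro i
    rw [tendsto_pi_nhds]
    intro K
    refine tendsto_nhdsWithin_of_tendsto_nhds ?_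
    have hc : Continuous fun t : ℂ => t ^ (e K - ε i) * b i K := by fun_prop
    convert hc.tendsto 0 using 2
    rw [hbb]
    by_cases hK : b i K = 0
    · simp [hK]
    · have := hε i K hK
      split_ifs with h
      · simp [h]
      · rw [zero_pow (by omega), zero_mul]
  · intro u hu K hK
    have hle : Submodule.span ℂ (Set.range b₀) ≤
        LinearMap.ker (LinearMap.proj K : (ι → ℂ) →ₗ[ℂ] ℂ) := by
      rw [Submodule.span_le]
      rintro _ ⟨i, rfl⟩
      simp only [SetLike.mem_coe, LinearMap.mem_ker, LinearMap.proj_apply, hbb]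
      rw [if_neg]
      intro h
      refine hb.ne_zero i (hW _ (hbW ▸ Submodule.subset_span ⟨i, rfl⟩) fun K' hK' => ?_)
      by_contra hne
      have := hε i K' hne
      omega
    simpa using hle hu

/-! ### Coordinates of the Segre-Veronese vector -/

section SegreVeronese

variable {r : ℕ} {n d : Fin r → ℕ}

/-- The monomial with factors listed by `c`. -/
def monomialOf (c : (p : Σ j, Fin (d j)) → Fin (n p.1 + 1)) : MonomialIndex n d :=
  fun j => ⟨Finset.univ.val.map fun a => c ⟨j, a⟩, by simp⟩

theorem Sym.exists_univ_map_eq {α : Type} {k : ℕ} (s : Sym α k) :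
    ∃ f : Fin k → α, (Finset.univ.val.map f : Multiset α) = s := by
  obtain ⟨s, rfl⟩ := s
  induction s using Quotient.inductionOn with
  | _ l =>
    refine ⟨l.get, ?_⟩
    change Multiset.map l.get Finset.univ.val = (l : Multiset α)
    rw [Fin.univ_val_map, List.ofFn_get]

theorem monomialOf_surjective : Function.Surjective (monomialOf (n := n) (d := d)) := by
  intro K
  choose f hf using fun j => Sym.exists_univ_map_eq (K j)
  exact ⟨fun p => f p.1 p.2, funext fun j => Subtype.ext (hf j)⟩

/-- A list of the factors of a monomial. -/
noncomputable def monomialFactor (K : MonomialIndex n d) :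
    (p : Σ j, Fin (d j)) → Fin (n p.1 + 1) :=
  Function.surjInv monomialOf_surjective K

@[simp] theorem monomialOf_monomialFactor (K : MonomialIndex n d) :
    monomialOf (monomialFactor K) = K :=
  Function.surjInv_eq monomialOf_surjective K

theorem segreVeroneseVector_monomialOf (y : (j : Fin r) → Fin (n j + 1) → ℂ)
    (c : (p : Σ j, Fin (d j)) → Fin (n p.1 + 1)) :
    segreVeroneseVector n d y (monomialOf c) = ∏ p, y p.1 (c p) := by
  rw [Fintype.prod_sigma]
  refine Finset.prod_congr rfl fun j _ => ?_
  change ((Finset.univ.val.map fun a => c ⟨j, a⟩).map (y j)).prod = _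
  rw [Multiset.map_map]
  rfl

theorem segreVeroneseVector_apply (y : (j : Fin r) → Fin (n j + 1) → ℂ) (K : MonomialIndex n d) :
    segreVeroneseVector n d y K = ∏ p, y p.1 (monomialFactor K p) := by
  rw [← segreVeroneseVector_monomialOf, monomialOf_monomialFactor]

theorem segreVeroneseVector_smul (a : Fin r → ℂ) (y : (j : Fin r) → Fin (n j + 1) → ℂ) :
    segreVeroneseVector n d (fun j => a j • y j) =
      (∏ j, a j ^ d j) • segreVeroneseVector n d y := by
  ext K
  rw [Pi.smul_apply, segreVeroneseVector_apply, segreVeroneseVector_apply]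
  simp only [Pi.smul_apply, smul_eq_mul, Finset.prod_mul_distrib]
  congr 1
  rw [Fintype.prod_sigma]
  simp

/-- Changing one factor changes a monomial by a ratio of coordinates; this recovers the coordinates
of a factor up to scale in `chartInverse`. -/
theorem segreVeroneseVector_update (y : (j : Fin r) → Fin (n j + 1) → ℂ)
    (c : (p : Σ j, Fin (d j)) → Fin (n p.1 + 1)) (p : Σ j, Fin (d j)) (l : Fin (n p.1 + 1)) :
    segreVeroneseVector n d y (monomialOf (Function.update c p l)) * y p.1 (c p) =
      segreVeroneseVector n d y (monomialOf c) * y p.1 l := by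
  rw [segreVeroneseVector_monomialOf, segreVeroneseVector_monomialOf,
    ← Finset.mul_prod_erase _ _ (Finset.mem_univ p), ← Finset.mul_prod_erase _ _ (Finset.mem_univ p),
    Function.update_self]
  rw [Finset.prod_congr rfl (g := fun q => y q.1 (c q)) fun q hq => by
    rw [Function.update_of_ne (Finset.ne_of_mem_erase hq)]]
  ring

theorem contDiff_segreVeroneseVector : ContDiff ℂ ⊤ (segreVeroneseVector n d) := by
  rw [contDiff_pi]
  intro K
  have : (fun y => segreVeroneseVector n d y K) = fun y => ∏ p, y p.1 (monomialFactor K p) :=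
    funext fun y => segreVeroneseVector_apply y K
  rw [this]
  exact contDiff_prod fun p _ => ((ContinuousLinearMap.proj (R := ℂ) (monomialFactor K p)).comp
    (ContinuousLinearMap.proj (R := ℂ) (φ := fun j : Fin r => Fin (n j + 1) → ℂ) p.1)).contDiff

/-- The exponent vector of a monomial. -/
noncomputable def monomialExponent (K : MonomialIndex n d) : (Σ j, Fin (n j + 1)) →₀ ℕ :=
  Finsupp.equivFunOnFinite.symm fun q => (K q.1 : Multiset (Fin (n q.1 + 1))).count q.2

theorem monomialExponent_injective : Function.Injective (monomialExponent (n := n) (d := d)) := by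
  intro K K' h
  funext j
  refine Subtype.ext (Multiset.ext.mpr fun i => ?_)
  exact DFunLike.congr_fun h (⟨j, i⟩ : Σ j, Fin (n j + 1))

theorem eval_monomial_monomialExponent (x : (Σ j, Fin (n j + 1)) → ℂ) (K : MonomialIndex n d)
    (a : ℂ) : MvPolynomial.eval x (MvPolynomial.monomial (monomialExponent K) a) =
      a * segreVeroneseVector n d (fun j i => x ⟨j, i⟩) K := by
  rw [MvPolynomial.eval_monomial]
  congr 1
  rw [Finsupp.prod_fintype _ _ (fun _ => pow_zero _), Fintype.prod_sigma]
  refine Finset.prod_congr rfl fun j _ => ?_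
  rw [Finset.prod_multiset_map_count]
  symm
  refine Finset.prod_subset (Finset.subset_univ _) fun i _ hi => ?_
  rw [Multiset.mem_toFinset, ← Multiset.count_eq_zero] at hi
  rw [hi, pow_zero]

/-- A linear form vanishing on the Segre-Veronese vectors of one affine chart is zero. -/
theorem linearForm_eq_zero_of_segreVeroneseVector (f : (MonomialIndex n d → ℂ) →ₗ[ℂ] ℂ)
    (h : ∀ y : (j : Fin r) → Fin (n j + 1) → ℂ, (∀ j, y j 0 = 1) →
      f (segreVeroneseVector n d y) = 0) : f = 0 := by
  classical
  let P : MvPolynomial (Σ j, Fin (n j + 1)) ℂ :=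
    ∑ K : MonomialIndex n d, MvPolynomial.monomial (monomialExponent K) (f (Pi.single K 1))
  let Q : MvPolynomial (Σ j, Fin (n j + 1)) ℂ := ∏ j, MvPolynomial.X ⟨j, 0⟩
  have heval : ∀ x, MvPolynomial.eval x P = f (segreVeroneseVector n d fun j i => x ⟨j, i⟩) := by
    intro x
    conv_rhs => rw [pi_eq_sum_univ' (segreVeroneseVector n d fun j i => x ⟨j, i⟩)]
    simp only [P, map_sum, eval_monomial_monomialExponent, map_smul, smul_eq_mul]
    refine Finset.sum_congr rfl fun K _ => ?_
    rw [mul_comm]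
  -- Where no first coordinate vanishes, multihomogeneity rescales every factor into the chart;
  -- elsewhere `Q` vanishes. Distinct indices give distinct monomials, so `P = 0` kills every
  -- coefficient of `f`.
  have hPQ : Q * P = 0 := by
    refine MvPolynomial.funext fun x => ?_
    rw [map_mul, heval, map_zero]
    by_cases hx : ∀ j, x ⟨j, 0⟩ ≠ 0
    · have h1 := segreVeroneseVector_smul (n := n) (d := d) (fun j => x ⟨j, 0⟩)
        fun j i => (x ⟨j, 0⟩)⁻¹ * x ⟨j, i⟩
      have h2 : (fun j => x ⟨j, 0⟩ • fun i => (x ⟨j, 0⟩)⁻¹ * x ⟨j, i⟩) =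
          fun (j : Fin r) (i : Fin (n j + 1)) => x ⟨j, i⟩ := by
        ext j i
        simp [hx j]
      rw [h2] at h1
      rw [h1, map_smul, h _ fun j => by simp [hx j]]
      simp
    · push Not at hx
      obtain ⟨j, hj⟩ := hx
      simp only [Q, map_prod, MvPolynomial.eval_X]
      rw [Finset.prod_eq_zero (Finset.mem_univ j) hj, zero_mul]
  have hQ : Q ≠ 0 := Finset.prod_ne_zero_iff.mpr fun j _ => MvPolynomial.X_ne_zero _
  have hP : P = 0 := (mul_eq_zero.mp hPQ).resolve_left hQ
  refine LinearMap.pi_ext' fun K => LinearMap.ext_ring ?_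
  have h1 := congrArg (MvPolynomial.coeff (monomialExponent K)) hP
  simp only [P, MvPolynomial.coeff_sum, MvPolynomial.coeff_monomial,
    monomialExponent_injective.eq_iff, Finset.sum_ite_eq', Finset.mem_univ, if_true,
    MvPolynomial.coeff_zero] at h1
  simpa using h1

theorem linearMap_ext_segreVeroneseVector {f g : (MonomialIndex n d → ℂ) →ₗ[ℂ] (MonomialIndex n d → ℂ)}
    (h : ∀ y, f (segreVeroneseVector n d y) = g (segreVeroneseVector n d y)) : f = g := by
  ext1 K
  refine LinearMap.ext fun x => funext fun K' => ?_
  have := linearForm_eq_zero_of_segreVeroneseVector ((LinearMap.proj K').comp (f - g))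
    fun y _ => by simp [h]
  have := LinearMap.congr_fun this (Pi.single K x)
  simpa [sub_eq_zero] using this

/-- The linear map of monomial coordinates induced by linear substitutions. -/
noncomputable def segreVeroneseMap
    (g : (j : Fin r) → (Fin (n j + 1) → ℂ) →ₗ[ℂ] (Fin (n j + 1) → ℂ)) :
    (MonomialIndex n d → ℂ) →ₗ[ℂ] (MonomialIndex n d → ℂ) :=
  LinearMap.pi fun K => ∑ c : (p : Σ j, Fin (d j)) → Fin (n p.1 + 1),
    (∏ p, g p.1 (Pi.single (c p) 1) (monomialFactor K p)) • LinearMap.proj (monomialOf c)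

/-- Multiplying out a product of linear forms gives one term per list `c` of chosen variables.
Several lists may name the same monomial, so their terms are added. -/
theorem segreVeroneseMap_segreVeroneseVector
    (g : (j : Fin r) → (Fin (n j + 1) → ℂ) →ₗ[ℂ] (Fin (n j + 1) → ℂ))
    (y : (j : Fin r) → Fin (n j + 1) → ℂ) :
    segreVeroneseMap g (segreVeroneseVector n d y) =
      segreVeroneseVector n d fun j => g j (y j) := by
  ext K
  have h1 : ∀ p : Σ j, Fin (d j), g p.1 (y p.1) (monomialFactor K p) =
      ∑ l, g p.1 (Pi.single l 1) (monomialFactor K p) * y p.1 l := by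
    intro p
    conv_lhs => rw [LinearMap.pi_apply_eq_sum_univ (g p.1) (y p.1)]
    simp only [Finset.sum_apply, Pi.smul_apply, smul_eq_mul]
    refine Finset.sum_congr rfl fun l _ => ?_
    rw [mul_comm]
    congr! 3
    simp [Pi.single_apply, eq_comm]
  rw [segreVeroneseVector_apply (fun j => g j (y j))]
  simp only [h1, Finset.prod_univ_sum, Fintype.piFinset_univ, segreVeroneseMap,
    LinearMap.pi_apply, LinearMap.sum_apply, LinearMap.smul_apply, LinearMap.proj_apply,
    segreVeroneseVector_monomialOf, smul_eq_mul, Finset.prod_mul_distrib]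

/-- Composing with the map of the inverse substitutions fixes all Segre-Veronese vectors, and these
span. -/
theorem segreVeroneseMap_injective
    (g : (j : Fin r) → (Fin (n j + 1) → ℂ) ≃ₗ[ℂ] (Fin (n j + 1) → ℂ)) :
    Function.Injective (segreVeroneseMap (d := d) fun j => (g j).toLinearMap) := by
  have h : (segreVeroneseMap fun j => (g j).symm.toLinearMap) ∘ₗ
      (segreVeroneseMap fun j => (g j).toLinearMap) =
      (LinearMap.id : (MonomialIndex n d → ℂ) →ₗ[ℂ] _) := by
    refine linearMap_ext_segreVeroneseVector fun y => ?_
    simp [segreVeroneseMap_segreVeroneseVector]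
  exact Function.LeftInverse.injective (g := segreVeroneseMap fun j => (g j).symm.toLinearMap)
    fun x => LinearMap.congr_fun h x

/-- The number of factors of a monomial other than the first coordinates. -/
def monomialWeight (K : MonomialIndex n d) : ℕ :=
  ∑ j, (K j : Multiset (Fin (n j + 1))).countP (· ≠ 0)

theorem monomialWeight_monomialOf (c : (p : Σ j, Fin (d j)) → Fin (n p.1 + 1)) :
    monomialWeight (monomialOf c) = (Finset.univ.filter fun p => c p ≠ 0).card := by
  rw [Finset.card_filter, Fintype.sum_sigma]
  refine Finset.sum_congr rfl fun j _ => ?_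
  rw [← Finset.card_filter]
  change Multiset.countP (fun x : Fin (n j + 1) => x ≠ 0)
    (Finset.univ.val.map fun a : Fin (d j) => (c ⟨j, a⟩ : Fin (n j + 1))) = _
  rw [Multiset.countP_map]
  rfl

/-- Scaling of the coordinates other than the first ones. -/
noncomputable def scaleTail (n : Fin r → ℕ) {t : ℂ} (ht : t ≠ 0) (j : Fin r) :
    (Fin (n j + 1) → ℂ) ≃ₗ[ℂ] (Fin (n j + 1) → ℂ) :=
  LinearEquiv.piCongrRight fun l =>
    LinearEquiv.smulOfNeZero ℂ ℂ (if l = 0 then 1 else t) (by split_ifs <;> simp [ht])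

@[simp] theorem scaleTail_apply {t : ℂ} (ht : t ≠ 0) (j : Fin r) (y : Fin (n j + 1) → ℂ)
    (l : Fin (n j + 1)) : scaleTail n ht j y l = (if l = 0 then 1 else t) * y l := rfl

/-- Each of the `∑ j, d j` factors contributes `s` or `t`. The case `s = 1` is the torus action; the
case where all `y j l` are `1` is the standard line. -/
theorem segreVeroneseVector_mul_ite (s t : ℂ) (y : (j : Fin r) → Fin (n j + 1) → ℂ)
    (K : MonomialIndex n d) :
    segreVeroneseVector n d (fun j l => (if l = 0 then s else t) * y j l) K =
      s ^ (∑ j, d j - monomialWeight K) * t ^ monomialWeight K * segreVeroneseVector n d y K := by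
  obtain ⟨c, rfl⟩ := monomialOf_surjective K
  rw [segreVeroneseVector_monomialOf, segreVeroneseVector_monomialOf, Finset.prod_mul_distrib,
    Finset.prod_ite, Finset.prod_const, Finset.prod_const, monomialWeight_monomialOf]
  have := Finset.card_filter_add_card_filter_not (s := Finset.univ)
    fun p : (Σ j, Fin (d j)) => c p = 0
  rw [Finset.card_univ, Fintype.card_sigma] at this
  simp only [Fintype.card_fin] at this
  rw [← this, Nat.add_sub_cancel]

theorem diagonalAction_segreVeroneseVector (t : ℂ) (y : (j : Fin r) → Fin (n j + 1) → ℂ) :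
    diagonalAction monomialWeight t (segreVeroneseVector n d y) =
      segreVeroneseVector n d fun j l => (if l = 0 then 1 else t) * y j l := by
  ext K
  rw [segreVeroneseVector_mul_ite, one_pow, one_mul]
  rfl

end SegreVeronese

/-! ### Osculating spaces of Segre-Veronese varieties -/

section Osculating

variable {r : ℕ} {n d : Fin r → ℕ}

/-- The point of the Segre-Veronese variety with given homogeneous coordinates of the factors. -/
noncomputable def segreVeronesePoint (n d : Fin r → ℕ) (v : (j : Fin r) → Fin (n j + 1) → ℂ)
    (hv : ∀ j, v j ≠ 0) : ℙ ℂ (MonomialIndex n d → ℂ) :=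
  Projectivization.mk ℂ (segreVeroneseVector n d v) (segreVeroneseVector_ne_zero n d v hv)

/-- Recovers the coordinates of the factors, scaled to agree with `v` in the coordinates `c`. -/
noncomputable def chartInverse (hd : ∀ j, 0 < d j) (v : (j : Fin r) → Fin (n j + 1) → ℂ)
    (c : (p : Σ j, Fin (d j)) → Fin (n p.1 + 1)) :
    (MonomialIndex n d → ℂ) →L[ℂ] ((j : Fin r) → Fin (n j + 1) → ℂ) :=
  ContinuousLinearMap.pi fun j => ContinuousLinearMap.pi fun l =>
    v j (c ⟨j, ⟨0, hd j⟩⟩) •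
      ContinuousLinearMap.proj (monomialOf (Function.update c ⟨j, ⟨0, hd j⟩⟩ l))

theorem chartInverse_smul_segreVeroneseVector (hd : ∀ j, 0 < d j)
    (v y : (j : Fin r) → Fin (n j + 1) → ℂ) (c : (p : Σ j, Fin (d j)) → Fin (n p.1 + 1)) (b : ℂ)
    (hb : b * segreVeroneseVector n d y (monomialOf c) = 1) :
    chartInverse hd v c (b • segreVeroneseVector n d y) =
      fun j => (v j (c ⟨j, ⟨0, hd j⟩⟩) / y j (c ⟨j, ⟨0, hd j⟩⟩)) • y j := by
  have hy : ∀ p, y p.1 (c p) ≠ 0 := by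
    rw [segreVeroneseVector_monomialOf] at hb
    intro p hp
    rw [Finset.prod_eq_zero (Finset.mem_univ p) hp, mul_zero] at hb
    exact zero_ne_one hb
  ext j l
  have h1 := segreVeroneseVector_update y c ⟨j, ⟨0, hd j⟩⟩ l
  have h2 := hy ⟨j, ⟨0, hd j⟩⟩
  simp only at h1 h2
  simp only [chartInverse, ContinuousLinearMap.pi_apply, _root_.smul_apply,
    ContinuousLinearMap.proj_apply, Pi.smul_apply, smul_eq_mul]
  rw [div_mul_eq_mul_div, eq_div_iff h2]
  linear_combination v j (c ⟨j, ⟨0, hd j⟩⟩) * (b * h1 + y j l * hb)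

theorem exists_smul_eq_of_mem_affinePart {u : MonomialIndex n d → ℂ} {K : MonomialIndex n d}
    (hu : u ∈ affinePart (segreVeronese n d) K) :
    ∃ (y : (j : Fin r) → Fin (n j + 1) → ℂ) (b : ℂ), u = b • segreVeroneseVector n d y ∧
      b * segreVeroneseVector n d y K = 1 := by
  obtain ⟨hK, h0, y, hy, h⟩ := hu
  obtain ⟨b, hb⟩ := (Projectivization.mk_eq_mk_iff' ℂ _ _ h0 _).mp h
  refine ⟨y, b, hb.symm, ?_⟩
  rw [← hK, ← hb]
  rfl

/-- `chartInverse` returns the factors of `u` up to rescaling, so the resulting vector is a multiple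
of `u`; the normalization of `u` in the chart determines the multiple. -/
theorem segreVeroneseVector_chartInverse (hd : ∀ j, 0 < d j)
    (v : (j : Fin r) → Fin (n j + 1) → ℂ) (c : (p : Σ j, Fin (d j)) → Fin (n p.1 + 1))
    (hv : ∀ p, v p.1 (c p) ≠ 0) {u : MonomialIndex n d → ℂ}
    (hu : u ∈ affinePart (segreVeronese n d) (monomialOf c)) :
    u = (segreVeroneseVector n d (chartInverse hd v c u) (monomialOf c))⁻¹ •
        segreVeroneseVector n d (chartInverse hd v c u) ∧
    ∀ j, chartInverse hd v c u j (c ⟨j, ⟨0, hd j⟩⟩) = v j (c ⟨j, ⟨0, hd j⟩⟩) := by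
  obtain ⟨y, b, rfl, hb⟩ := exists_smul_eq_of_mem_affinePart hu
  have hy : ∀ p, y p.1 (c p) ≠ 0 := by
    rw [segreVeroneseVector_monomialOf] at hb
    intro p hp
    rw [Finset.prod_eq_zero (Finset.mem_univ p) hp, mul_zero] at hb
    exact zero_ne_one hb
  have hy0 : segreVeroneseVector n d y (monomialOf c) ≠ 0 := right_ne_zero_of_mul_eq_one hb
  have ha : ∏ j, (v j (c ⟨j, ⟨0, hd j⟩⟩) / y j (c ⟨j, ⟨0, hd j⟩⟩)) ^ d j ≠ 0 :=
    Finset.prod_ne_zero_iff.mpr fun j _ => pow_ne_zero _ (div_ne_zero (hv ⟨j, _⟩) (hy ⟨j, _⟩))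
  rw [chartInverse_smul_segreVeroneseVector hd v y c b hb, segreVeroneseVector_smul]
  refine ⟨?_, fun j => ?_⟩
  · rw [smul_smul, Pi.smul_apply, smul_eq_mul]
    congr 1
    rw [eq_comm, ← mul_left_inj' hy0, hb]
    field_simp
  · have := hy ⟨j, ⟨0, hd j⟩⟩
    simp only [Pi.smul_apply, smul_eq_mul]
    field_simp

/-- For any local parametrization, `φ z` is a bounded scalar times the Segre-Veronese vector at `L
(φ z)`, and `L (φ z) - v = O(z)`. Orders of vanishing on the cone thus pass to `φ`. -/
theorem isBigO_of_mem_affinePart (hd : ∀ j, 0 < d j) (v : (j : Fin r) → Fin (n j + 1) → ℂ)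
    (hv : ∀ j, v j ≠ 0) {N : ℕ} {K : MonomialIndex n d} {φ : (Fin N → ℂ) → (MonomialIndex n d → ℂ)}
    (hφ : IsLocalParametrization (segreVeronese n d) (segreVeronesePoint n d v hv) K φ)
    (f : (MonomialIndex n d → ℂ) →ₗ[ℂ] ℂ) (m : ℕ)
    (h : (fun x => f (segreVeroneseVector n d (v + x))) =O[𝓝 0] fun x => ‖x‖ ^ (m + 1)) :
    (fun z => f (φ z)) =O[𝓝 0] fun z => ‖z‖ ^ (m + 1) := by
  obtain ⟨c, rfl⟩ := monomialOf_surjective K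
  obtain ⟨hK, h0, hmk⟩ := hφ.map_zero
  obtain ⟨b, hb⟩ := (Projectivization.mk_eq_mk_iff' ℂ _ _ h0 _).mp hmk
  have hb1 : b * segreVeroneseVector n d v (monomialOf c) = 1 := by
    rw [← hK, ← hb]
    rfl
  have hvc : ∀ p, v p.1 (c p) ≠ 0 := by
    have hb := hb1
    rw [segreVeroneseVector_monomialOf] at hb
    intro p hp
    rw [Finset.prod_eq_zero (Finset.mem_univ p) hp, mul_zero] at hb
    exact zero_ne_one hb
  set L := chartInverse hd v c
  have hL0 : L (φ 0) = v := by
    rw [← hb, chartInverse_smul_segreVeroneseVector hd v v c b hb1]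
    ext j l
    have := hvc ⟨j, ⟨0, hd j⟩⟩
    simp only at this
    simp [this]
  have hcont : ContinuousAt φ 0 := hφ.analyticAt.continuousAt
  have hx : (fun z => L (φ z) - v) =O[𝓝 0] fun z => z := by
    have h1 := (hφ.analyticAt.differentiableAt.hasFDerivAt).isBigO_sub
    have h2 := (L.isBigO_comp (fun z => φ z - φ 0) (𝓝 0)).trans h1
    simpa [hL0] using h2
  have hx0 : Tendsto (fun z => L (φ z) - v) (𝓝 0) (𝓝 0) :=
    hx.trans_tendsto tendsto_id
  have h1 := (h.comp_tendsto hx0).trans ((hx.norm_norm).pow (m + 1))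
  have h2 : (fun z => (segreVeroneseVector n d (L (φ z)) (monomialOf c))⁻¹) =O[𝓝 0]
      fun _ => (1 : ℝ) := by
    have : ContinuousAt (fun z => (segreVeroneseVector n d (L (φ z)) (monomialOf c))⁻¹) 0 := by
      refine ContinuousAt.inv₀ ?_ ?_
      · have h3 : Continuous fun y => segreVeroneseVector n d y (monomialOf c) :=
          (continuous_apply _).comp contDiff_segreVeroneseVector.continuous
        exact h3.continuousAt.comp (L.continuous.continuousAt.comp hcont)
      · rw [hL0]
        exact right_ne_zero_of_mul_eq_one hb1
    exact this.tendsto.isBigO_one ℝ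
  have hmem : ∀ᶠ z in 𝓝 0, φ z ∈ affinePart (segreVeronese n d) (monomialOf c) := by
    have h3 : Tendsto φ (𝓝 0) (𝓝[affinePart (segreVeronese n d) (monomialOf c)] (φ 0)) :=
      hφ.map_nhds.le
    exact h3.eventually self_mem_nhdsWithin
  refine (h2.mul h1).congr' ?_ ?_
  · filter_upwards [hmem] with z hz
    conv_rhs => rw [(segreVeroneseVector_chartInverse hd v c hvc hz).1, map_smul]
    simp [L]
  · filter_upwards with z
    simp

/-- The inclusion of the affine coordinates complementary to the coordinates `i j`. -/
noncomputable def affineInclusion (i : (j : Fin r) → Fin (n j + 1)) {N : ℕ}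
    (e : {p : Σ j, Fin (n j + 1) // p.2 ≠ i p.1} ≃ Fin N) :
    (Fin N → ℂ) →L[ℂ] ((j : Fin r) → Fin (n j + 1) → ℂ) :=
  ContinuousLinearMap.pi fun j => ContinuousLinearMap.pi fun l =>
    if h : l ≠ i j then ContinuousLinearMap.proj (e ⟨⟨j, l⟩, h⟩) else 0

theorem affineInclusion_apply_self (i : (j : Fin r) → Fin (n j + 1)) {N : ℕ}
    (e : {p : Σ j, Fin (n j + 1) // p.2 ≠ i p.1} ≃ Fin N) (z : Fin N → ℂ) (j : Fin r) :
    affineInclusion i e z j (i j) = 0 := by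
  simp [affineInclusion]

theorem affineInclusion_symm (i : (j : Fin r) → Fin (n j + 1)) {N : ℕ}
    (e : {p : Σ j, Fin (n j + 1) // p.2 ≠ i p.1} ≃ Fin N) (z : Fin N → ℂ) (a : Fin N) :
    affineInclusion i e z (e.symm a).1.1 (e.symm a).1.2 = z a := by
  have := (e.symm a).2
  simp [affineInclusion, this]

theorem affineInclusion_coord (i : (j : Fin r) → Fin (n j + 1)) {N : ℕ}
    (e : {p : Σ j, Fin (n j + 1) // p.2 ≠ i p.1} ≃ Fin N)
    (x : (j : Fin r) → Fin (n j + 1) → ℂ) (hx : ∀ j, x j (i j) = 0) :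
    affineInclusion i e (fun a => x (e.symm a).1.1 (e.symm a).1.2) = x := by
  ext j l
  by_cases h : l = i j
  · subst h
    rw [affineInclusion_apply_self, hx]
  · have h1 := congrArg (fun q => x q.1.1 q.1.2) (e.symm_apply_apply ⟨⟨j, l⟩, h⟩)
    simpa [affineInclusion, h] using h1

/-- The standard affine parametrization at the point over `v`. -/
noncomputable def affineParametrization (d : Fin r → ℕ) (v : (j : Fin r) → Fin (n j + 1) → ℂ)
    (i : (j : Fin r) → Fin (n j + 1)) {N : ℕ}
    (e : {p : Σ j, Fin (n j + 1) // p.2 ≠ i p.1} ≃ Fin N) (z : Fin N → ℂ) :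
    MonomialIndex n d → ℂ :=
  (segreVeroneseVector n d v (monomialOf fun p => i p.1))⁻¹ •
    segreVeroneseVector n d (v + affineInclusion i e z)

/-- The left inverse is `chartInverse`, read off in the coordinates other than the `i j`; it is
linear up to a translation and defined on the whole space. -/
theorem isLocalParametrization_affineParametrization (hd : ∀ j, 0 < d j)
    (v : (j : Fin r) → Fin (n j + 1) → ℂ) (hv : ∀ j, v j ≠ 0)
    (i : (j : Fin r) → Fin (n j + 1)) (hi : ∀ j, v j (i j) ≠ 0) {N : ℕ}
    (e : {p : Σ j, Fin (n j + 1) // p.2 ≠ i p.1} ≃ Fin N) :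
    IsLocalParametrization (segreVeronese n d) (segreVeronesePoint n d v hv)
      (monomialOf fun p => i p.1) (affineParametrization d v i e) := by
  set c : (p : Σ j, Fin (d j)) → Fin (n p.1 + 1) := fun p => i p.1
  have hvc : ∀ p, v p.1 (c p) ≠ 0 := fun p => hi p.1
  have hSV : segreVeroneseVector n d v (monomialOf c) ≠ 0 := by
    rw [segreVeroneseVector_monomialOf]
    exact Finset.prod_ne_zero_iff.mpr fun p _ => hvc p
  have hSVz : ∀ y : (j : Fin r) → Fin (n j + 1) → ℂ, (∀ j, y j (i j) = v j (i j)) →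
      segreVeroneseVector n d y (monomialOf c) = segreVeroneseVector n d v (monomialOf c) := by
    intro y hy
    simp only [segreVeroneseVector_monomialOf, c, hy]
  have hself : ∀ z j, (v + affineInclusion i e z) j (i j) = v j (i j) := by
    intro z j
    simp only [Pi.add_apply, affineInclusion_apply_self, add_zero]
  have hchart : ∀ z, affineParametrization d v i e z ∈
      affinePart (segreVeronese n d) (monomialOf c) := by
    intro z
    have h1 : affineParametrization d v i e z (monomialOf c) = 1 := by
      simp only [affineParametrization, Pi.smul_apply, smul_eq_mul]
      rw [hSVz _ (hself z)]
      exact inv_mul_cancel₀ hSV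
    refine ⟨h1, fun h => by rw [h] at h1; exact zero_ne_one h1, v + affineInclusion i e z,
      fun j h => ?_, ?_⟩
    · have := hself z j
      rw [h] at this
      exact hi j this.symm
    · rw [Projectivization.mk_eq_mk_iff']
      exact ⟨_, rfl⟩
  refine IsLocalParametrization.of_leftInverse
    (ψ := fun u a => (chartInverse hd v c u - v) (e.symm a).1.1 (e.symm a).1.2) ?_ ?_ ?_ ?_ ?_
  · have h1 : ContDiff ℂ ⊤ (affineParametrization d v i e) := by
      refine ContDiff.const_smul _ (contDiff_segreVeroneseVector.comp ?_)
      exact contDiff_const.add (affineInclusion i e).contDiff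
    exact contDiff_omega_iff_analyticOnNhd.mp h1
  · rw [differentiable_pi]
    intro a
    have h1 : Differentiable ℂ fun u => chartInverse hd v c u - v :=
      (chartInverse hd v c).differentiable.sub_const v
    exact differentiable_pi.mp (differentiable_pi.mp h1 (e.symm a).1.1) (e.symm a).1.2
  · intro z
    funext a
    have h1 := chartInverse_smul_segreVeroneseVector hd v (v + affineInclusion i e z) c
      (segreVeroneseVector n d v (monomialOf c))⁻¹
      (by rw [hSVz _ (hself z)]; exact inv_mul_cancel₀ hSV)
    change (chartInverse hd v c ((segreVeroneseVector n d v (monomialOf c))⁻¹ •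
      segreVeroneseVector n d (v + affineInclusion i e z)) - v) _ _ = _
    rw [h1]
    simp only [c, Pi.sub_apply]
    rw [hself, div_self (hi _), one_smul, Pi.add_apply, Pi.add_apply, add_sub_cancel_left,
      affineInclusion_symm]
  · refine Set.Subset.antisymm ?_ fun u hu => ?_
    · rintro _ ⟨z, rfl⟩
      exact hchart z
    · obtain ⟨h2, h3⟩ := segreVeroneseVector_chartInverse hd v c hvc hu
      refine ⟨fun a => (chartInverse hd v c u - v) (e.symm a).1.1 (e.symm a).1.2, ?_⟩
      rw [affineParametrization, affineInclusion_coord, add_sub_cancel]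
      · rw [← hSVz (chartInverse hd v c u) h3]
        exact h2.symm
      · intro j
        rw [Pi.sub_apply, Pi.sub_apply, sub_eq_zero]
        exact h3 j
  · obtain ⟨h1, h2, -⟩ := hchart 0
    refine ⟨h1, h2, ?_⟩
    rw [Set.mem_singleton_iff, segreVeronesePoint, Projectivization.mk_eq_mk_iff']
    exact ⟨(segreVeroneseVector n d v (monomialOf c))⁻¹, by simp [affineParametrization, c]⟩

/-- Rescaling every factor of `v + x` so that its coordinate `i j` agrees with that of `v` gives an
affine parameter `z x = O(x)`; multihomogeneity then costs only a factor bounded near `0`. -/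
theorem isBigO_of_affineParametrization
    (v : (j : Fin r) → Fin (n j + 1) → ℂ)
    (i : (j : Fin r) → Fin (n j + 1)) (hi : ∀ j, v j (i j) ≠ 0) {N : ℕ}
    (e : {p : Σ j, Fin (n j + 1) // p.2 ≠ i p.1} ≃ Fin N)
    (f : (MonomialIndex n d → ℂ) →ₗ[ℂ] ℂ) (m : ℕ)
    (h : (fun z => f (affineParametrization d v i e z)) =O[𝓝 0] fun z => ‖z‖ ^ (m + 1)) :
    (fun x => f (segreVeroneseVector n d (v + x))) =O[𝓝 0] fun x => ‖x‖ ^ (m + 1) := by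
  have hSV : segreVeroneseVector n d v (monomialOf fun p => i p.1) ≠ 0 := by
    rw [segreVeroneseVector_monomialOf]
    exact Finset.prod_ne_zero_iff.mpr fun p _ => hi p.1
  let ζ : ((j : Fin r) → Fin (n j + 1) → ℂ) → (j : Fin r) → Fin (n j + 1) → ℂ :=
    fun x j l => v j (i j) / (v + x) j (i j) * (v + x) j l - v j l
  let z : ((j : Fin r) → Fin (n j + 1) → ℂ) → (Fin N → ℂ) :=
    fun x a => ζ x (e.symm a).1.1 (e.symm a).1.2
  have hcoord : ∀ j l, Differentiable ℂ fun x : (j : Fin r) → Fin (n j + 1) → ℂ => (v + x) j l := by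
    intro j l
    have h1 : Differentiable ℂ fun x : (j : Fin r) → Fin (n j + 1) → ℂ => v + x :=
      differentiable_id.const_add v
    exact differentiable_pi.mp (differentiable_pi.mp h1 j) l
  have hz0 : z 0 = 0 := by
    funext a
    simp [z, ζ, hi]
  have hzd : DifferentiableAt ℂ z 0 := by
    rw [differentiableAt_pi]
    intro a
    have h1 : ∀ j, DifferentiableAt ℂ (fun x : (j : Fin r) → Fin (n j + 1) → ℂ =>
        v j (i j) * ((v + x) j (i j))⁻¹) 0 := fun j =>
      (((hcoord j (i j)) 0).fun_inv (by simpa using hi j)).const_mul _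
    simp only [← div_eq_mul_inv] at h1
    exact ((h1 _).fun_mul ((hcoord _ _) 0)).sub_const _
  have hz : z =O[𝓝 0] fun x => x := by
    simpa [hz0] using hzd.hasFDerivAt.isBigO_sub
  have h1 := (h.comp_tendsto (hz.trans_tendsto tendsto_id)).trans (hz.norm_norm.pow (m + 1))
  have h2 : (fun x : (j : Fin r) → Fin (n j + 1) → ℂ =>
      (∏ j, ((v + x) j (i j) / v j (i j)) ^ d j) *
        segreVeroneseVector n d v (monomialOf fun p => i p.1)) =O[𝓝 0] fun _ => (1 : ℝ) := by
    have : Continuous fun x : (j : Fin r) → Fin (n j + 1) → ℂ =>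
        (∏ j, ((v + x) j (i j) / v j (i j)) ^ d j) *
        segreVeroneseVector n d v (monomialOf fun p => i p.1) := by
      refine Continuous.mul (continuous_finsetProd _ fun j _ => ?_) continuous_const
      exact ((hcoord _ _).continuous.div_const _).pow _
    exact (this.tendsto 0).isBigO_one ℝ
  have hne : ∀ᶠ x : (j : Fin r) → Fin (n j + 1) → ℂ in 𝓝 0, ∀ j, (v + x) j (i j) ≠ 0 := by
    rw [eventually_all]
    intro j
    exact (hcoord j (i j)).continuous.continuousAt.eventually_ne (by simpa using hi j)
  refine (h2.mul h1).congr' ?_ ?_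
  · filter_upwards [hne] with x hx
    have h3 : v + affineInclusion i e (z x) =
        fun j => (v j (i j) / (v + x) j (i j)) • (v + x) j := by
      rw [affineInclusion_coord i e (ζ x) fun j => by
        simp only [ζ]
        rw [div_mul_cancel₀ _ (hx j), sub_self]]
      ext j l
      simp [ζ]
    simp only [Function.comp_apply, affineParametrization, h3, segreVeroneseVector_smul, map_smul,
      smul_eq_mul]
    have h4 : (∏ j, ((v + x) j (i j) / v j (i j)) ^ d j) *
        (∏ j, (v j (i j) / (v + x) j (i j)) ^ d j) = 1 := by
      rw [← Finset.prod_mul_distrib]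
      refine Finset.prod_eq_one fun j _ => ?_
      rw [← mul_pow, div_mul_div_cancel₀ (hi j), div_self (hx j), one_pow]
    field_simp
    linear_combination f (segreVeroneseVector n d (v + x)) * h4
  · filter_upwards with x
    simp

/-- The linear forms vanishing on an osculating space are those of high order of contact. -/
theorem forall_osculatingSpace_eq_zero_iff (hd : ∀ j, 0 < d j)
    (v : (j : Fin r) → Fin (n j + 1) → ℂ) (hv : ∀ j, v j ≠ 0) (m : ℕ)
    (f : (MonomialIndex n d → ℂ) →ₗ[ℂ] ℂ) :
    (∀ w ∈ osculatingSpace (segreVeronese n d) (segreVeronesePoint n d v hv) m, f w = 0) ↔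
      (fun x => f (segreVeroneseVector n d (v + x))) =O[𝓝 0] fun x => ‖x‖ ^ (m + 1) := by
  let F : (MonomialIndex n d → ℂ) →L[ℂ] ℂ := LinearMap.toContinuousLinearMap f
  have hF : ∀ {N : ℕ} {φ : (Fin N → ℂ) → (MonomialIndex n d → ℂ)}, AnalyticAt ℂ φ 0 →
      ∀ k (s : Fin k → Fin N), iteratedFDeriv ℂ k (fun z => f (φ z)) 0
        (fun a => Pi.single (s a) 1) =
      f (iteratedFDeriv ℂ k φ 0 (fun a => Pi.single (s a) 1)) := by
    intro N φ hφ k s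
    have h1 := F.iteratedFDeriv_comp_left (hφ.contDiffAt (n := ⊤)) (i := k) le_top
    exact DFunLike.congr_fun h1 _
  have hA : ∀ {N : ℕ} {φ : (Fin N → ℂ) → (MonomialIndex n d → ℂ)}, AnalyticAt ℂ φ 0 →
      AnalyticAt ℂ (fun z => f (φ z)) 0 := fun hφ => (F.analyticAt _).comp hφ
  constructor
  · intro h
    choose i hi using fun j => Function.ne_iff.mp (hv j)
    let e := Fintype.equivFin {p : Σ j, Fin (n j + 1) // p.2 ≠ i p.1}
    have hφ := isLocalParametrization_affineParametrization hd v hv i hi e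
    refine isBigO_of_affineParametrization v i hi e f m ?_
    rw [(hA hφ.analyticAt).isBigO_pow_iff_iteratedFDeriv_eq_zero]
    intro k hk s
    rw [hF hφ.analyticAt]
    exact h _ (Submodule.subset_span ⟨_, _, _, hφ, k, hk, s, rfl⟩)
  · intro h w hw
    change w ∈ LinearMap.ker f
    revert w
    change _ ≤ LinearMap.ker f
    rw [osculatingSpace, Submodule.span_le]
    rintro _ ⟨N, K, φ, hφ, k, hk, s, rfl⟩
    have h1 := isBigO_of_mem_affinePart hd v hv hφ f m h
    rw [(hA hφ.analyticAt).isBigO_pow_iff_iteratedFDeriv_eq_zero] at h1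
    have := h1 k hk s
    rw [hF hφ.analyticAt] at this
    exact this

end Osculating

/-! ### Equivariance of osculating spaces and their equations at two standard points. -/

theorem Submodule.eq_of_forall_dual {V : Type*} [AddCommGroup V] [Module ℂ V] {W W' : Submodule ℂ V}
    (h : ∀ f : V →ₗ[ℂ] ℂ, (∀ w ∈ W, f w = 0) ↔ ∀ w ∈ W', f w = 0) : W = W' := by
  refine Subspace.dualAnnihilator_inj.mp (SetLike.ext fun f => ?_)
  rw [Submodule.mem_dualAnnihilator, Submodule.mem_dualAnnihilator]
  exact h f

theorem isBigO_prod_norm_pow {E ι : Type*} [NormedAddCommGroup E] [Fintype ι] {F : ι → E → ℂ}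
    {a : ι → ℕ} (h : ∀ i, F i =O[𝓝 0] fun x => ‖x‖ ^ a i) {m : ℕ} (hm : m ≤ ∑ i, a i) :
    (fun x => ∏ i, F i x) =O[𝓝 0] fun x => ‖x‖ ^ m := by
  have h1 := Asymptotics.IsBigO.finsetProd (s := Finset.univ) fun i _ => h i
  refine h1.trans (Asymptotics.IsBigO.of_bound 1 ?_)
  filter_upwards [Metric.closedBall_mem_nhds (0 : E) one_pos] with x hx
  have hx' : ‖x‖ ≤ 1 := by simpa using hx
  rw [Finset.prod_pow_eq_pow_sum]
  simpa using pow_le_pow_of_le_one (norm_nonneg x) hx' hm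

section Standard

variable {r : ℕ} {n d : Fin r → ℕ}

/-- By duality, this is the invariance of the order of vanishing under invertible linear changes of
`x`. The map `G` is left abstract so that it can be `segreVeroneseMap` or `diagonalAction`. -/
theorem osculatingSpace_map (hd : ∀ j, 0 < d j)
    (g : (j : Fin r) → (Fin (n j + 1) → ℂ) ≃ₗ[ℂ] (Fin (n j + 1) → ℂ))
    (G : (MonomialIndex n d → ℂ) →ₗ[ℂ] (MonomialIndex n d → ℂ))
    (hG : ∀ y, G (segreVeroneseVector n d y) = segreVeroneseVector n d fun j => g j (y j))
    (v v' : (j : Fin r) → Fin (n j + 1) → ℂ) (hv : ∀ j, v j ≠ 0) (hv' : ∀ j, v' j ≠ 0)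
    (hvv' : ∀ j, v' j = g j (v j)) (m : ℕ) :
    osculatingSpace (segreVeronese n d) (segreVeronesePoint n d v' hv') m =
      (osculatingSpace (segreVeronese n d) (segreVeronesePoint n d v hv) m).map G := by
  refine Submodule.eq_of_forall_dual fun f => ?_
  have h1 : (∀ w ∈ (osculatingSpace (segreVeronese n d) (segreVeronesePoint n d v hv) m).map G,
      f w = 0) ↔
      ∀ w ∈ osculatingSpace (segreVeronese n d) (segreVeronesePoint n d v hv) m, (f ∘ₗ G) w = 0 := by
    simp [Submodule.mem_map]
  rw [h1, forall_osculatingSpace_eq_zero_iff hd, forall_osculatingSpace_eq_zero_iff hd]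
  let g' : ((j : Fin r) → Fin (n j + 1) → ℂ) ≃L[ℂ] ((j : Fin r) → Fin (n j + 1) → ℂ) :=
    (LinearEquiv.piCongrRight g).toContinuousLinearEquiv
  have h2 : ∀ x, f (segreVeroneseVector n d (v' + g' x)) =
      (f ∘ₗ G) (segreVeroneseVector n d (v + x)) := by
    intro x
    rw [LinearMap.comp_apply, hG]
    congr 2
    ext1 j
    simp [hvv', g']
  have h3 : ∀ e : ((j : Fin r) → Fin (n j + 1) → ℂ) ≃L[ℂ] ((j : Fin r) → Fin (n j + 1) → ℂ),
      Tendsto e (𝓝 0) (𝓝 0) := fun e => by simpa using e.continuous.tendsto 0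
  have h4 : ∀ e : ((j : Fin r) → Fin (n j + 1) → ℂ) ≃L[ℂ] ((j : Fin r) → Fin (n j + 1) → ℂ),
      (fun x => ‖e x‖ ^ (m + 1)) =O[𝓝 0] fun x => ‖x‖ ^ (m + 1) := fun e =>
    (e.toContinuousLinearMap.isBigO_id (𝓝 0)).norm_norm.pow (m + 1)
  constructor
  · intro h
    refine ((h.comp_tendsto (h3 g')).trans (h4 g')).congr_left fun x => ?_
    exact h2 x
  · intro h
    refine ((h.comp_tendsto (h3 g'.symm)).trans (h4 g'.symm)).congr_left fun x => ?_
    rw [Function.comp_apply, ← h2, ContinuousLinearEquiv.apply_symm_apply]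

/-- The first coordinate point of every factor. -/
def firstPoint (n : Fin r → ℕ) (j : Fin r) : Fin (n j + 1) → ℂ := Pi.single 0 1

theorem firstPoint_ne_zero (j : Fin r) : firstPoint n j ≠ 0 := by simp [firstPoint]

theorem allOnes_ne_zero (j : Fin r) : (fun _ => 1 : Fin (n j + 1) → ℂ) ≠ 0 :=
  Function.ne_iff.mpr ⟨0, one_ne_zero⟩

theorem isBigO_coord (j : Fin r) (l : Fin (n j + 1)) :
    (fun x : (j : Fin r) → Fin (n j + 1) → ℂ => x j l) =O[𝓝 0] fun x => ‖x‖ :=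
  Asymptotics.IsBigO.of_bound 1 (Eventually.of_forall fun x => by
    simpa using (norm_le_pi_norm (x j) l).trans (norm_le_pi_norm x j))

theorem isBigO_const_add_coord (a : ℂ) (j : Fin r) (l : Fin (n j + 1)) :
    (fun x : (j : Fin r) → Fin (n j + 1) → ℂ => a + x j l) =O[𝓝 0] fun x => ‖x‖ ^ 0 := by
  have : Continuous fun x : (j : Fin r) → Fin (n j + 1) → ℂ => a + x j l := by fun_prop
  simpa using (this.tendsto 0).isBigO_one ℝ

/-- Every factor other than a first coordinate vanishes at `firstPoint`, so the monomial `K`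
vanishes there to order at least its weight. -/
theorem apply_eq_zero_of_mem_osculatingSpace_firstPoint (hd : ∀ j, 0 < d j) {m : ℕ}
    {w : MonomialIndex n d → ℂ}
    (hw : w ∈ osculatingSpace (segreVeronese n d)
      (segreVeronesePoint n d (firstPoint n) firstPoint_ne_zero) m)
    {K : MonomialIndex n d} (hK : m < monomialWeight K) : w K = 0 := by
  refine (forall_osculatingSpace_eq_zero_iff hd (firstPoint n) firstPoint_ne_zero m
    (LinearMap.proj K)).mpr ?_ w hw
  obtain ⟨c, rfl⟩ := monomialOf_surjective K
  simp only [LinearMap.proj_apply, segreVeroneseVector_monomialOf]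
  refine isBigO_prod_norm_pow (a := fun p => if c p ≠ 0 then 1 else 0) (fun p => ?_) ?_
  · by_cases h : c p = 0
    · simp only [h, ne_eq, not_true_eq_false, if_false, Pi.add_apply]
      exact isBigO_const_add_coord _ _ _
    · simp only [ne_eq, h, not_false_eq_true, if_true, pow_one, Pi.add_apply, firstPoint,
        Pi.single_eq_of_ne h, zero_add]
      exact isBigO_coord _ _
  · rw [← Finset.card_filter, ← monomialWeight_monomialOf]
    exact hK

/-- Let `f` annihilate the osculating space. Along the segment from `firstPoint` to a chart point
`y`, its pullback is a polynomial in `t` whose coefficients are the weight parts of `f` at `y`.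
Contact of order `m + 1` kills the parts of weight at most `m`. -/
theorem mem_osculatingSpace_firstPoint (hd : ∀ j, 0 < d j) {m : ℕ} {w : MonomialIndex n d → ℂ}
    (hw : ∀ K, m < monomialWeight K → w K = 0) :
    w ∈ osculatingSpace (segreVeronese n d)
      (segreVeronesePoint n d (firstPoint n) firstPoint_ne_zero) m := by
  classical
  rw [← Subspace.forall_mem_dualAnnihilator_apply_eq_zero_iff]
  intro f hf
  rw [Submodule.mem_dualAnnihilator, forall_osculatingSpace_eq_zero_iff hd] at hf
  let fk : ℕ → (MonomialIndex n d → ℂ) →ₗ[ℂ] ℂ := fun k =>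
    ∑ K, if monomialWeight K = k then f (Pi.single K 1) • LinearMap.proj K else 0
  have hexp : ∀ u, f u = ∑ K, f (Pi.single K 1) * u K := by
    intro u
    conv_lhs => rw [pi_eq_sum_univ' u]
    simp only [map_sum, map_smul, smul_eq_mul]
    exact Finset.sum_congr rfl fun K _ => mul_comm _ _
  have hfk : ∀ k ≤ m, fk k = 0 := by
    intro k hk
    refine linearForm_eq_zero_of_segreVeroneseVector _ fun y hy => ?_
    let P : Polynomial ℂ := ∑ K, Polynomial.monomial (monomialWeight K)
      (f (Pi.single K 1) * segreVeroneseVector n d y K)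
    have hP : ∀ t, P.eval t = f (segreVeroneseVector n d (firstPoint n + t • (y - firstPoint n))) := by
      intro t
      have h1 : firstPoint n + t • (y - firstPoint n) =
          fun j l => (if l = 0 then 1 else t) * y j l := by
        ext j l
        by_cases hl : l = 0
        · subst hl
          simp [firstPoint, hy]
        · simp [firstPoint, hl]
      rw [h1, ← diagonalAction_segreVeroneseVector, hexp]
      simp only [P, Polynomial.eval_finsetSum, Polynomial.eval_monomial, diagonalAction_apply]
      exact Finset.sum_congr rfl fun K _ => by ring
    have h2 : (fun t : ℂ => P.eval t) =O[𝓝 0] fun t => ‖t‖ ^ (m + 1) := by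
      have h3 : Tendsto (fun t : ℂ => t • (y - firstPoint n)) (𝓝 0) (𝓝 0) := by
        have : Continuous fun t : ℂ => t • (y - firstPoint n) := by fun_prop
        simpa using this.tendsto 0
      have h4 : (fun t : ℂ => ‖t • (y - firstPoint n)‖ ^ (m + 1)) =O[𝓝 0]
          fun t => ‖t‖ ^ (m + 1) := by
        refine Asymptotics.IsBigO.pow ?_ _
        refine Asymptotics.IsBigO.of_bound ‖y - firstPoint n‖ (Eventually.of_forall fun t => ?_)
        simp [norm_smul, mul_comm]
      refine ((hf.comp_tendsto h3).trans h4).congr_left fun t => ?_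
      rw [hP]
      rfl
    have h5 := Polynomial.coeff_eq_zero_of_isBigO h2 k hk
    simp only [P, Polynomial.finsetSum_coeff, Polynomial.coeff_monomial] at h5
    rw [← h5]
    simp only [fk, LinearMap.sum_apply]
    refine Finset.sum_congr rfl fun K _ => ?_
    split_ifs <;> simp
  rw [hexp]
  refine Finset.sum_eq_zero fun K _ => ?_
  by_cases hK : monomialWeight K ≤ m
  · have h1 := LinearMap.congr_fun (hfk _ hK) (Pi.single K 1)
    simp only [fk, LinearMap.sum_apply, LinearMap.zero_apply] at h1
    rw [Finset.sum_eq_single K] at h1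
    · simp only [if_true, LinearMap.smul_apply, LinearMap.proj_apply, Pi.single_eq_same,
        smul_eq_mul, mul_one] at h1
      rw [h1, zero_mul]
    · intro K' _ hK'
      split_ifs <;> simp [hK']
    · simp
  · rw [hw K (by omega), mul_zero]

/-- On the cone the alternating sum is a product containing the `m + 1` factors `y (c p) - y 0` for
`p ∈ A`, each vanishing at the all-ones point. -/
theorem sum_powerset_eq_zero_of_mem_osculatingSpace_allOnes (hd : ∀ j, 0 < d j) {m : ℕ}
    {u : MonomialIndex n d → ℂ}
    (hu : u ∈ osculatingSpace (segreVeronese n d)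
      (segreVeronesePoint n d (fun _ _ => 1) allOnes_ne_zero) m)
    (c : (p : Σ j, Fin (d j)) → Fin (n p.1 + 1)) (A : Finset (Σ j, Fin (d j)))
    (hA : A.card = m + 1) :
    ∑ B ∈ A.powerset, (-1) ^ B.card * u (monomialOf fun p => if p ∈ B then 0 else c p) = 0 := by
  have key := (forall_osculatingSpace_eq_zero_iff hd (fun _ _ => 1) allOnes_ne_zero m
    (∑ B ∈ A.powerset, (-1 : ℂ) ^ B.card •
      LinearMap.proj (monomialOf fun p => if p ∈ B then 0 else c p))).mpr ?_ u hu
  · simpa using key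
  · have h1 : ∀ y : (j : Fin r) → Fin (n j + 1) → ℂ,
        (∑ B ∈ A.powerset, (-1 : ℂ) ^ B.card •
          (LinearMap.proj (monomialOf fun p => if p ∈ B then 0 else c p) :
            (MonomialIndex n d → ℂ) →ₗ[ℂ] ℂ)) (segreVeroneseVector n d y) =
        ∏ p, if p ∈ A then y p.1 (c p) - y p.1 0 else y p.1 (c p) := by
      intro y
      have h2 : ∀ B, B ⊆ A → ∏ p, y p.1 (if p ∈ B then 0 else c p) =
          ((∏ p ∈ A \ B, y p.1 (c p)) * ∏ p ∈ B, y p.1 0) * ∏ p ∈ Aᶜ, y p.1 (c p) := by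
        intro B hB
        rw [← Finset.prod_mul_prod_compl A, ← Finset.prod_sdiff hB]
        congr 1
        · congr 1
          · exact Finset.prod_congr rfl fun p hp => by rw [if_neg (Finset.mem_sdiff.mp hp).2]
          · exact Finset.prod_congr rfl fun p hp => by rw [if_pos hp]
        · exact Finset.prod_congr rfl fun p hp => by
            rw [if_neg fun h => Finset.mem_compl.mp hp (hB h)]
      rw [← Finset.prod_mul_prod_compl A, Finset.prod_congr rfl fun p hp => if_pos hp,
        Finset.prod_congr (s₁ := Aᶜ) rfl fun p hp => if_neg (Finset.mem_compl.mp hp),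
        Finset.prod_sub, Finset.sum_mul]
      simp only [LinearMap.sum_apply, LinearMap.smul_apply, LinearMap.proj_apply, smul_eq_mul,
        segreVeroneseVector_monomialOf]
      refine Finset.sum_congr rfl fun B hB => ?_
      rw [h2 B (Finset.mem_powerset.mp hB)]
      ring
    simp only [h1]
    refine isBigO_prod_norm_pow (a := fun p => if p ∈ A then 1 else 0) (fun p => ?_) ?_
    · by_cases h : p ∈ A
      · simp only [h, if_true, pow_one, Pi.add_apply, add_sub_add_left_eq_sub]
        exact (isBigO_coord _ _).sub (isBigO_coord _ _)
      · simp only [h, if_false, Pi.add_apply]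
        exact isBigO_const_add_coord _ _ _
    · simp [hA]

theorem eq_zero_of_mem_sup_osculatingSpace (hd : ∀ j, 0 < d j) (k₁ k₂ : ℕ)
    (w : MonomialIndex n d → ℂ)
    (hw : w ∈ osculatingSpace (segreVeronese n d)
        (segreVeronesePoint n d (firstPoint n) firstPoint_ne_zero) k₁ ⊔
      osculatingSpace (segreVeronese n d)
        (segreVeronesePoint n d (fun _ _ => 1) allOnes_ne_zero) k₂)
    (h : ∀ K, monomialWeight K ≤ k₁ + k₂ + 1 → w K = 0) : w = 0 := by
  obtain ⟨y, hy, u, hu, rfl⟩ := Submodule.mem_sup.mp hw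
  have hy0 : ∀ K, k₁ < monomialWeight K → y K = 0 := fun K hK =>
    apply_eq_zero_of_mem_osculatingSpace_firstPoint hd hy hK
  have hu0 : ∀ N, ∀ c : (p : Σ j, Fin (d j)) → Fin (n p.1 + 1),
      monomialWeight (monomialOf c) = N → k₁ < N → u (monomialOf c) = 0 := by
    intro N
    induction N using Nat.strong_induction_on with
    | _ N ih =>
      intro c hc hN
      by_cases hN' : N ≤ k₁ + k₂ + 1
      · have h1 := h (monomialOf c) (by omega)
        rwa [Pi.add_apply, hy0 _ (by omega), zero_add] at h1
      -- Replacing a nonempty `B ⊆ A` by first coordinates lowers the weight to `N - B.card`, which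
      -- is less than `N` and, as `B.card ≤ k₂ + 1`, still above `k₁`. By induction only the term `B
      -- = ∅` survives.
      · obtain ⟨A, hA, hAc⟩ := Finset.exists_subset_card_eq
          (s := Finset.univ.filter fun p => c p ≠ 0) (n := k₂ + 1)
          (by rw [← monomialWeight_monomialOf]; omega)
        have h1 := sum_powerset_eq_zero_of_mem_osculatingSpace_allOnes hd hu c A hAc
        rw [Finset.sum_eq_single ∅] at h1
        · simpa using h1
        · intro B hB hB0
          rw [Finset.mem_powerset] at hB
          have h2 : (Finset.univ.filter fun p => (if p ∈ B then 0 else c p) ≠ 0) =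
              (Finset.univ.filter fun p => c p ≠ 0) \ B := by
            ext p
            by_cases hp : p ∈ B <;> simp [hp]
          have h3 : monomialWeight (monomialOf fun p => if p ∈ B then 0 else c p) =
              N - B.card := by
            rw [monomialWeight_monomialOf, h2, Finset.card_sdiff_of_subset (hB.trans hA),
              ← monomialWeight_monomialOf, hc]
          have h4 := Finset.card_le_card hB
          have h5 := Finset.card_pos.mpr (Finset.nonempty_iff_ne_empty.mpr hB0)
          rw [ih _ (by omega) _ h3 (by omega), mul_zero]
        · simp
  ext K
  by_cases hK : monomialWeight K ≤ k₁ + k₂ + 1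
  · exact h K hK
  · rw [Pi.add_apply, hy0 K (by omega), Pi.zero_apply, zero_add]
    obtain ⟨c, rfl⟩ := monomialOf_surjective K
    exact hu0 _ c rfl (by omega)

end Standard

/-! ### The projective line -/

theorem MvPolynomial.IsHomogeneous.eval_smul_vector {σ : Type} {F : MvPolynomial σ ℂ} {k : ℕ}
    (hF : F.IsHomogeneous k) (a : ℂ) (x : σ → ℂ) :
    MvPolynomial.eval (a • x) F = a ^ k * MvPolynomial.eval x F := by
  rw [MvPolynomial.eval_eq, MvPolynomial.eval_eq, Finset.mul_sum]
  refine Finset.sum_congr rfl fun e he => ?_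
  have h1 := hF (MvPolynomial.mem_support_iff.mp he)
  simp only [Pi.smul_apply, smul_eq_mul, mul_pow, Finset.prod_mul_distrib, Finset.prod_pow_eq_pow_sum]
  rw [← h1, Finsupp.weight_apply, Finsupp.sum]
  simp
  ring

theorem IsZariskiClosed.exists_eval_ne_zero_of_ne_univ {M : ℕ} {Z : Set (ℙ ℂ (Fin (M + 1) → ℂ))}
    (hZ : IsZariskiClosed Z) (h : ¬Set.univ ⊆ Z) :
    ∃ F : MvPolynomial (Fin (M + 1)) ℂ, F ≠ 0 ∧
      ∀ (v : Fin (M + 1) → ℂ) (hv : v ≠ 0), MvPolynomial.eval v F ≠ 0 →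
        Projectivization.mk ℂ v hv ∉ Z := by
  obtain ⟨S, hS, rfl⟩ := hZ
  simp only [Set.subset_def, Set.mem_univ, Set.mem_ofPred_eq, true_implies, not_forall] at h
  obtain ⟨x, F, hF, hx⟩ := h
  refine ⟨F, by rintro rfl; simp at hx, fun v hv hvF hmem => ?_⟩
  obtain ⟨k, hk⟩ := hS F hF
  obtain ⟨a, ha⟩ := Projectivization.exists_smul_eq_mk_rep ℂ v hv
  have h1 := hmem F hF
  rw [← ha, Units.smul_def, hk.eval_smul_vector] at h1
  simp [hvF] at h1

theorem isSmoothCurve_projectiveLine : IsSmoothCurve (Set.univ : Set (ℙ ℂ (Fin (1 + 1) → ℂ))) where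
  nonempty := ⟨Projectivization.mk ℂ (fun _ => 1) (Function.ne_iff.mpr ⟨0, one_ne_zero⟩), trivial⟩
  locallyClosed := by
    refine ⟨Set.univ, ∅, ⟨∅, by simp, by simp⟩, ⟨{1}, ?_, ?_⟩, by simp⟩
    · rintro F rfl
      exact ⟨0, MvPolynomial.isHomogeneous_one _ _⟩
    · ext x
      simp
  irreducible := by
    intro Z Z' hZ hZ' h
    by_contra! hne
    obtain ⟨F, hF, hFZ⟩ := IsZariskiClosed.exists_eval_ne_zero_of_ne_univ hZ hne.1
    obtain ⟨F', hF', hFZ'⟩ := IsZariskiClosed.exists_eval_ne_zero_of_ne_univ hZ' hne.2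
    -- The factor `X 0` forces the vector found below to be nonzero, so that it represents a point.
    have h1 : MvPolynomial.X 0 * (F * F') ≠ 0 :=
      mul_ne_zero (MvPolynomial.X_ne_zero _) (mul_ne_zero hF hF')
    obtain ⟨x, hx⟩ : ∃ x, MvPolynomial.eval x (MvPolynomial.X 0 * (F * F')) ≠ 0 := by
      by_contra! hx
      exact h1 (MvPolynomial.funext fun x => by rw [hx, map_zero])
    simp only [map_mul, MvPolynomial.eval_X, mul_ne_zero_iff] at hx
    have hx0 : x ≠ 0 := Function.ne_iff.mpr ⟨0, hx.1⟩
    rcases h (Set.mem_univ (Projectivization.mk ℂ x hx0)) with h2 | h2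
    · exact hFZ x hx0 hx.2.1 h2
    · exact hFZ' x hx0 hx.2.2 h2
  smooth := by
    intro x _
    obtain ⟨i, hi⟩ := Function.ne_iff.mp x.rep_nonzero
    obtain ⟨j, hij, hj⟩ : ∃ j : Fin (1 + 1), i ≠ j ∧ ∀ l, l = i ∨ l = j := by
      refine ⟨i + 1, ?_, ?_⟩ <;> clear hi <;> revert i <;> decide
    let A : (Fin 1 → ℂ) →L[ℂ] (Fin (1 + 1) → ℂ) :=
      (ContinuousLinearMap.proj 0).smulRight (Pi.single j 1)
    let b : Fin (1 + 1) → ℂ := (x.rep i)⁻¹ • x.rep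
    have hbi : b i = 1 := by simpa [b] using inv_mul_cancel₀ hi
    refine ⟨i, fun z => b + A z, IsLocalParametrization.of_leftInverse
      (ψ := fun u _ => u j - b j) ?_ ?_ ?_ ?_ ?_⟩
    · exact fun z _ => analyticAt_const.add (A.analyticAt z)
    · fun_prop
    · intro z
      ext l
      simp [A, Subsingleton.elim l 0]
    · refine Set.Subset.antisymm ?_ fun u hu => ⟨fun _ => u j - b j, ?_⟩
      · rintro _ ⟨z, rfl⟩
        have h1 : (b + A z) i = 1 := by simp [A, hbi, hij]
        exact ⟨h1, fun h => zero_ne_one ((congrFun h i).symm.trans h1), trivial⟩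
      · have hui : u i = 1 := hu.1
        ext l
        rcases hj l with rfl | rfl
        · simp [A, hij, hui, hbi]
        · simp [A]
    · have hb0 : b ≠ 0 := fun h => by rw [h] at hbi; exact zero_ne_one hbi
      refine ⟨by simpa using hbi, by simpa using hb0, ?_⟩
      have : x = Projectivization.mk ℂ x.rep x.rep_nonzero := x.mk_rep.symm
      rw [Set.mem_singleton_iff, this, Projectivization.mk_eq_mk_iff']
      exact ⟨(x.rep i)⁻¹, by simp [b]⟩

/-- The affine coordinate on the projective line. -/
noncomputable def affineCoordinate (y : ℙ ℂ (Fin 2 → ℂ)) : ℂ := y.rep 1 / y.rep 0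

/-- The origin of the affine coordinate. -/
noncomputable def lineOrigin : ℙ ℂ (Fin 2 → ℂ) :=
  Projectivization.mk ℂ ![1, 0] (Function.ne_iff.mpr ⟨0, one_ne_zero⟩)

/-- The point at infinity of the affine coordinate. -/
noncomputable def lineInfinity : ℙ ℂ (Fin 2 → ℂ) :=
  Projectivization.mk ℂ ![0, 1] (Function.ne_iff.mpr ⟨1, one_ne_zero⟩)

/-- Both conditions are unchanged when the representative is rescaled, so they can be tested on the
punctured plane. -/
theorem isOpen_affineCoordinate_preimage {U : Set ℂ} (hU : IsOpen U) :
    IsOpen {y : ℙ ℂ (Fin 2 → ℂ) | y.rep 0 ≠ 0 ∧ affineCoordinate y ∈ U} := by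
  rw [isOpen_coinduced]
  have h1 : (Projectivization.mk' ℂ) ⁻¹' {y : ℙ ℂ (Fin 2 → ℂ) | y.rep 0 ≠ 0 ∧
      affineCoordinate y ∈ U} =
      {u : {v : Fin 2 → ℂ // v ≠ 0} | u.1 0 ≠ 0} ∩ (fun u => u.1 1 / u.1 0) ⁻¹' U := by
    ext u
    obtain ⟨a, ha⟩ := Projectivization.exists_smul_eq_mk_rep ℂ u.1 u.2
    simp only [Set.mem_preimage, Set.mem_ofPred_eq, Set.mem_inter_iff, affineCoordinate,
      Projectivization.mk'_eq_mk]
    rw [← ha]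
    simp [Units.smul_def, mul_div_mul_left]
  rw [h1]
  have hc : ∀ i, Continuous fun u : {v : Fin 2 → ℂ // v ≠ 0} => u.1 i := fun i =>
    (continuous_apply i).comp continuous_subtype_val
  refine ContinuousOn.isOpen_inter_preimage ?_ (isOpen_ne_fun (hc 0) continuous_const) hU
  exact (hc 1).continuousOn.div (hc 0).continuousOn fun u hu => hu

theorem lineOrigin_rep : lineOrigin.rep 0 ≠ 0 ∧ lineOrigin.rep 1 = 0 := by
  obtain ⟨a, ha⟩ := Projectivization.exists_smul_eq_mk_rep ℂ (![1, 0] : Fin 2 → ℂ)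
    (Function.ne_iff.mpr ⟨0, one_ne_zero⟩)
  rw [lineOrigin, ← ha]
  simp [Units.smul_def]

theorem eq_lineOrigin {y : ℙ ℂ (Fin 2 → ℂ)} (h0 : y.rep 0 ≠ 0) (h1 : affineCoordinate y = 0) :
    y = lineOrigin := by
  have : y = Projectivization.mk ℂ y.rep y.rep_nonzero := y.mk_rep.symm
  rw [this, lineOrigin, Projectivization.mk_eq_mk_iff']
  refine ⟨y.rep 0, ?_⟩
  have h2 : y.rep 1 = 0 := by simpa [affineCoordinate, h0] using h1
  ext i
  fin_cases i <;> simp [h2]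

theorem eventually_rep_ne_zero :
    ∀ᶠ y in 𝓝[Set.univ \ {lineOrigin}] lineOrigin, y.rep 0 ≠ 0 := by
  refine nhdsWithin_le_nhds ?_
  filter_upwards [(isOpen_affineCoordinate_preimage isOpen_univ).mem_nhds
    (show _ ∈ _ from ⟨lineOrigin_rep.1, trivial⟩)] with y hy using hy.1

theorem tendsto_affineCoordinate :
    Tendsto affineCoordinate (𝓝[Set.univ \ {lineOrigin}] lineOrigin) (𝓝[≠] 0) := by
  refine tendsto_nhdsWithin_iff.mpr ⟨tendsto_nhdsWithin_of_tendsto_nhds ?_, ?_⟩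
  · rw [tendsto_nhds]
    intro U hU h0
    filter_upwards [(isOpen_affineCoordinate_preimage hU).mem_nhds (show _ ∈ _ from
      ⟨lineOrigin_rep.1, by simpa [affineCoordinate, lineOrigin_rep.2] using h0⟩)] with y hy
      using hy.2
  · filter_upwards [eventually_rep_ne_zero, self_mem_nhdsWithin] with y hy hy'
    exact fun h => hy'.2 (eq_lineOrigin hy h)

theorem IsFlatLimit.map {ι B B' : Type} [Fintype ι] {T : B → Submodule ℂ (ι → ℂ)} {l : Filter B}
    {T₀ : Submodule ℂ (ι → ℂ)} (h : IsFlatLimit T l T₀) {l' : Filter B'} {τ : B' → B}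
    (hτ : Tendsto τ l' l) (G : (ι → ℂ) →ₗ[ℂ] (ι → ℂ)) (hG : Function.Injective G)
    {T' : B' → Submodule ℂ (ι → ℂ)} (hT' : ∀ᶠ y in l', T' y = (T (τ y)).map G) :
    IsFlatLimit T' l' (T₀.map G) := by
  obtain ⟨m, b, b₀, hb, hb₀, hT₀, hlim⟩ := h
  have hspan : ∀ c : Fin m → (ι → ℂ), Submodule.span ℂ (Set.range fun i => G (c i)) =
      (Submodule.span ℂ (Set.range c)).map G := by
    intro c
    rw [Submodule.map_span, ← Set.range_comp]
    rfl
  refine ⟨m, fun y i => G (b (τ y) i), fun i => G (b₀ i), ?_,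
    hb₀.map' G (LinearMap.ker_eq_bot.mpr hG), by rw [hspan, hT₀], ?_⟩
  · filter_upwards [hτ.eventually hb, hT'] with y hy hy'
    exact ⟨hy.1.map' G (LinearMap.ker_eq_bot.mpr hG), by rw [hspan, hy.2, hy']⟩
  · rw [tendsto_pi_nhds]
    intro i
    have h1 := (tendsto_pi_nhds.mp hlim i).comp hτ
    exact (G.continuous_of_finiteDimensional.tendsto _).comp h1

/-! ### The rational normal curve through two general points -/

theorem fin_last_ne_zero {m : ℕ} (hm : 0 < m) : Fin.last m ≠ 0 :=
  fun h => hm.ne' (congrArg Fin.val h)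

section Curve

variable {r : ℕ} {n d : Fin r → ℕ}

theorem segreVeronesePoint_eq_of_smul {v w : (j : Fin r) → Fin (n j + 1) → ℂ} (hv : ∀ j, v j ≠ 0)
    (hw : ∀ j, w j ≠ 0) (a : ℂ) (h : ∀ j, v j = a • w j) :
    segreVeronesePoint n d v hv = segreVeronesePoint n d w hw := by
  rw [segreVeronesePoint, segreVeronesePoint, Projectivization.mk_eq_mk_iff']
  refine ⟨∏ j, a ^ d j, ?_⟩
  rw [← segreVeroneseVector_smul]
  exact congrArg _ (funext fun j => (h j).symm)

/-- The line joining the first coordinate point to the point `(0, 1, …, 1)` in every factor. -/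
def standardLine (n : Fin r → ℕ) (u : Fin 2 → ℂ) (j : Fin r) : Fin (n j + 1) → ℂ :=
  fun l => if l = 0 then u 0 else u 1

theorem standardLine_ne_zero (hn : ∀ j, 0 < n j) {u : Fin 2 → ℂ} (hu : u ≠ 0) (j : Fin r) :
    standardLine n u j ≠ 0 := by
  intro h
  have h1 := congrFun h (Fin.last (n j))
  have h0 := congrFun h 0
  have hl : Fin.last (n j) ≠ 0 := fin_last_ne_zero (hn j)
  simp only [standardLine, hl, if_true, if_false, Pi.zero_apply] at h0 h1
  exact hu (funext fun i => by fin_cases i <;> simp [h0, h1])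

theorem standardLine_smul (a : ℂ) (u : Fin 2 → ℂ) (j : Fin r) :
    standardLine n (a • u) j = a • standardLine n u j := by
  ext l
  simp only [standardLine, Pi.smul_apply]
  split_ifs <;> rfl

theorem segreVeroneseVector_standardLine (u : Fin 2 → ℂ) (K : MonomialIndex n d) :
    segreVeroneseVector n d (standardLine n u) K =
      u 0 ^ (∑ j, d j - monomialWeight K) * u 1 ^ monomialWeight K := by
  have h1 := segreVeroneseVector_mul_ite (u 0) (u 1) (fun (j : Fin r) (_ : Fin (n j + 1)) => 1) K
  have h2 : segreVeroneseVector n d (fun _ _ => 1) K = 1 := by simp [segreVeroneseVector]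
  rw [h2] at h1
  simp only [mul_one] at h1
  exact h1

theorem monomialWeight_le (K : MonomialIndex n d) : monomialWeight K ≤ ∑ j, d j := by
  obtain ⟨c, rfl⟩ := monomialOf_surjective K
  rw [monomialWeight_monomialOf]
  refine (Finset.card_le_univ _).trans ?_
  simp

theorem exists_monomialWeight_eq (hn : ∀ j, 0 < n j) {l : ℕ} (hl : l ≤ ∑ j, d j) :
    ∃ K : MonomialIndex n d, monomialWeight K = l := by
  obtain ⟨A, -, hA⟩ := Finset.exists_subset_card_eq
    (s := (Finset.univ : Finset (Σ j, Fin (d j)))) (n := l) (by simpa using hl)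
  refine ⟨monomialOf fun p => if p ∈ A then Fin.last _ else 0, ?_⟩
  rw [monomialWeight_monomialOf, ← hA]
  congr 1
  ext p
  have := (hn p.1).ne'
  by_cases hp : p ∈ A <;> simp [hp, this]

variable (g : (j : Fin r) → (Fin (n j + 1) → ℂ) ≃ₗ[ℂ] (Fin (n j + 1) → ℂ))

theorem apply_standardLine_ne_zero (hn : ∀ j, 0 < n j) {u : Fin 2 → ℂ} (hu : u ≠ 0) (j : Fin r) :
    g j (standardLine n u j) ≠ 0 := by
  simpa using standardLine_ne_zero hn hu j

/-- The image of the standard line under coordinate changes of the factors. -/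
noncomputable def segreVeroneseCurve (d : Fin r → ℕ) (hn : ∀ j, 0 < n j) (y : ℙ ℂ (Fin 2 → ℂ)) :
    ℙ ℂ (MonomialIndex n d → ℂ) :=
  segreVeronesePoint n d (fun j => g j (standardLine n y.rep j))
    (apply_standardLine_ne_zero g hn y.rep_nonzero)

theorem segreVeroneseCurve_mk (hn : ∀ j, 0 < n j) (u : Fin 2 → ℂ) (hu : u ≠ 0) :
    segreVeroneseCurve g d hn (Projectivization.mk ℂ u hu) =
      segreVeronesePoint n d (fun j => g j (standardLine n u j))
        (apply_standardLine_ne_zero g hn hu) := by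
  obtain ⟨a, ha⟩ := Projectivization.exists_smul_eq_mk_rep ℂ u hu
  refine segreVeronesePoint_eq_of_smul _ _ (a : ℂ) fun j => ?_
  rw [← ha, Units.smul_def, standardLine_smul, map_smul]

theorem isRationalNormalCurve_segreVeroneseCurve (hn : ∀ j, 0 < n j) :
    IsRationalNormalCurve (∑ j, d j) (segreVeroneseCurve g d hn) := by
  let G := segreVeroneseMap (d := d) fun j => (g j).toLinearMap
  -- The monomials of weight `l` share the coefficient `s ^ (d - l) t ^ l`. Their indicator vectors
  -- have disjoint supports, nonempty because every weight up to `d` occurs.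
  let a : Fin (∑ j, d j + 1) → (MonomialIndex n d → ℂ) :=
    fun l K => if monomialWeight K = l then 1 else 0
  have ha : LinearIndependent ℂ a := by
    rw [Fintype.linearIndependent_iff]
    intro b hb l
    obtain ⟨K, hK⟩ := exists_monomialWeight_eq (n := n) (d := d) hn (Nat.lt_succ_iff.mp l.2)
    have h1 := congrFun hb K
    simpa [a, hK, Finset.sum_apply, Fin.val_inj] using h1
  have hsum : ∀ u : Fin 2 → ℂ, ∑ l : Fin (∑ j, d j + 1),
      (u 0 ^ (∑ j, d j - (l : ℕ)) * u 1 ^ (l : ℕ)) • G (a l) =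
      segreVeroneseVector n d fun j => g j (standardLine n u j) := by
    intro u
    have h1 : ∑ l : Fin (∑ j, d j + 1), (u 0 ^ (∑ j, d j - (l : ℕ)) * u 1 ^ (l : ℕ)) • a l =
        segreVeroneseVector n d (standardLine n u) := by
      ext K
      rw [segreVeroneseVector_standardLine, Finset.sum_apply,
        Finset.sum_eq_single ⟨monomialWeight K, Nat.lt_succ_iff.mpr (monomialWeight_le K)⟩]
      · simp [a]
      · intro l _ hl
        have : monomialWeight K ≠ l := fun h => hl (Fin.ext h.symm)
        simp [a, this]
      · simp
    have h2 := congrArg G h1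
    rw [map_sum] at h2
    simp only [map_smul] at h2
    rw [h2]
    exact segreVeroneseMap_segreVeroneseVector (fun j => (g j).toLinearMap) _
  refine ⟨fun l => G (a l),
    ha.map' G (LinearMap.ker_eq_bot.mpr (segreVeroneseMap_injective g)), fun u hu => ?_⟩
  simp only [hsum]
  exact ⟨segreVeroneseVector_ne_zero n d _ (apply_standardLine_ne_zero g hn hu),
    segreVeroneseCurve_mk g hn u hu⟩

theorem isMorphismOn_segreVeroneseCurve (hn : ∀ j, 0 < n j) :
    IsMorphismOn (M := 1) Set.univ (segreVeroneseCurve g d hn) := by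
  intro x _
  let G := segreVeroneseMap (d := d) fun j => (g j).toLinearMap
  let F : MonomialIndex n d → MvPolynomial (Fin (1 + 1)) ℂ := fun K =>
    ∑ K', MvPolynomial.C (G (Pi.single K' 1) K) *
      (MvPolynomial.X 0 ^ (∑ j, d j - monomialWeight K') * MvPolynomial.X 1 ^ monomialWeight K')
  have hF : ∀ u : Fin 2 → ℂ, (fun K => MvPolynomial.eval u (F K)) =
      segreVeroneseVector n d fun j => g j (standardLine n u j) := by
    intro u
    have h1 := segreVeroneseMap_segreVeroneseVector (d := d) (fun j => (g j).toLinearMap)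
      (standardLine n u)
    simp only [LinearEquiv.coe_coe] at h1
    rw [← h1]
    ext K
    conv_rhs => rw [pi_eq_sum_univ' (segreVeroneseVector n d (standardLine n u))]
    simp only [F, map_sum, map_smul, map_mul, map_pow, MvPolynomial.eval_C, MvPolynomial.eval_X,
      Finset.sum_apply, Pi.smul_apply, smul_eq_mul, segreVeroneseVector_standardLine]
    exact Finset.sum_congr rfl fun K' _ => mul_comm _ _
  refine ⟨∑ j, d j, F, fun K => ?_, ?_, fun y _ h => ?_⟩
  · refine MvPolynomial.IsHomogeneous.sum _ _ _ fun K' _ => ?_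
    have h1 := ((MvPolynomial.isHomogeneous_X ℂ (0 : Fin (1 + 1))).pow
      (∑ j, d j - monomialWeight K')).mul
      ((MvPolynomial.isHomogeneous_X ℂ (1 : Fin (1 + 1))).pow (monomialWeight K'))
    have h2 := h1.C_mul (G (Pi.single K' 1) K)
    rwa [one_mul, one_mul, Nat.sub_add_cancel (monomialWeight_le K')] at h2
  · rw [hF]
    exact segreVeroneseVector_ne_zero n d _ (apply_standardLine_ne_zero g hn x.rep_nonzero)
  · simp only [hF]
    rfl

theorem limitInOsculatingSpace_segreVeroneseCurve (hn : ∀ j, 0 < n j) (hd : ∀ j, 0 < d j)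
    (k₁ k₂ : ℕ) :
    LimitInOsculatingSpace (M := 1) (segreVeronese n d)
      (segreVeroneseCurve g d hn lineOrigin) k₁ k₂ Set.univ (segreVeroneseCurve g d hn)
      lineOrigin := by
  let G := segreVeroneseMap (d := d) fun j => (g j).toLinearMap
  have hG : ∀ y, G (segreVeroneseVector n d y) = segreVeroneseVector n d fun j => g j (y j) :=
    segreVeroneseMap_segreVeroneseVector fun j => (g j).toLinearMap
  let P₀ := segreVeronesePoint n d (firstPoint n) firstPoint_ne_zero
  let P₁ := segreVeronesePoint n d (fun _ _ => 1) allOnes_ne_zero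
  have hline : standardLine n ![1, 0] = firstPoint n := by
    ext j l
    simp [standardLine, firstPoint, Pi.single_apply]
  have hp : ∀ k, osculatingSpace (segreVeronese n d) (segreVeroneseCurve g d hn lineOrigin) k =
      (osculatingSpace (segreVeronese n d) P₀ k).map G := by
    intro k
    rw [lineOrigin, segreVeroneseCurve_mk]
    exact osculatingSpace_map hd g G hG _ _ _ _ (fun j => by rw [hline]) k
  obtain ⟨T₀, hT₀, hle⟩ := exists_isFlatLimit_diagonalAction monomialWeight
    (osculatingSpace (segreVeronese n d) P₀ k₁ ⊔ osculatingSpace (segreVeronese n d) P₁ k₂)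
    (k₁ + k₂ + 1) (eq_zero_of_mem_sup_osculatingSpace hd k₁ k₂)
  refine ⟨T₀.map G, hT₀.map tendsto_affineCoordinate G (segreVeroneseMap_injective g) ?_, ?_⟩
  · filter_upwards [eventually_rep_ne_zero, tendsto_affineCoordinate self_mem_nhdsWithin]
      with y hy0 hy1
    have ht : affineCoordinate y ≠ 0 := hy1
    set t := affineCoordinate y with ht_def
    have hΔ : ∀ y, diagonalAction monomialWeight t (segreVeroneseVector n d y) =
        segreVeroneseVector n d fun j => scaleTail n ht j (y j) :=
      diagonalAction_segreVeroneseVector t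
    -- The torus fixes `P₀`, hence its osculating space, so both summands are images under the same
    -- diagonal map.
    have h0 : osculatingSpace (segreVeronese n d) P₀ k₁ =
        (osculatingSpace (segreVeronese n d) P₀ k₁).map (diagonalAction monomialWeight t) := by
      refine osculatingSpace_map hd (scaleTail n ht) _ hΔ _ _ _ _ (fun j => ?_) k₁
      ext l
      by_cases hl : l = 0 <;> simp [firstPoint, hl]
    have hne : ∀ j, scaleTail n ht j (fun _ => 1) ≠ 0 := fun j => by
      simpa using allOnes_ne_zero j
    have h1 := osculatingSpace_map hd (scaleTail n ht) _ hΔ _ _ allOnes_ne_zero hne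
      (fun j => rfl) k₂
    have h2 := osculatingSpace_map hd g G hG _ (fun j => g j (scaleTail n ht j fun _ => 1)) hne
      (fun j => by simpa using hne j) (fun j => rfl) k₂
    have h3 : segreVeroneseCurve g d hn y = segreVeronesePoint n d
        (fun j => g j (scaleTail n ht j fun _ => 1)) (fun j => by simpa using hne j) := by
      -- On the line, `(y₀, y₁, …, y₁) = y₀ • (1, t, …, t)` with `t = y₁ / y₀`.
      refine segreVeronesePoint_eq_of_smul _ _ (y.rep 0) fun j => ?_
      rw [← map_smul]
      congr 1
      ext l
      by_cases hl : l = 0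
      · simp [standardLine, hl]
      · simp only [standardLine, hl, if_false, Pi.smul_apply, scaleTail_apply, smul_eq_mul, mul_one,
          ht_def, affineCoordinate]
        rw [mul_div_cancel₀ _ hy0]
    rw [hp, h3, h2, h1, Submodule.map_sup, Submodule.map_sup, ← h0]
  · rw [hp]
    exact Submodule.map_mono fun u hu => mem_osculatingSpace_firstPoint hd (hle u hu)

end Curve

/-! ### General pairs of points -/

theorem ForGeneralPair.mono {ι : Type} {X : Set (ℙ ℂ (ι → ℂ))}
    {P Q : ℙ ℂ (ι → ℂ) → ℙ ℂ (ι → ℂ) → Prop} (h : ForGeneralPair X P)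
    (hPQ : ∀ p q, P p q → Q p q) : ForGeneralPair X Q := by
  obtain ⟨F, hF, hP⟩ := h
  exact ⟨F, hF, fun v w hv hw hvX hwX hvw => hPQ _ _ (hP v w hv hw hvX hwX hvw)⟩

theorem cross_eq_of_not_linearIndependent {σ : Type} {v w : σ → ℂ}
    (h : ¬LinearIndependent ℂ ![v, w]) (i l : σ) : v i * w l = v l * w i := by
  rw [LinearIndependent.pair_iff] at h
  push Not at h
  obtain ⟨s, t, hst, h⟩ := h
  have hi := congrFun hst i
  have hl := congrFun hst l
  simp only [Pi.add_apply, Pi.smul_apply, smul_eq_mul, Pi.zero_apply] at hi hl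
  by_cases hs : s = 0
  · have ht := h hs
    have h1 : t * (v i * w l - v l * w i) = 0 := by linear_combination v i * hl - v l * hi
    exact sub_eq_zero.mp ((mul_eq_zero.mp h1).resolve_left ht)
  · have h1 : s * (v i * w l - v l * w i) = 0 := by linear_combination w l * hi - w i * hl
    exact sub_eq_zero.mp ((mul_eq_zero.mp h1).resolve_left hs)

/-- The polynomial is a product over `j` of 2 by 2 minors in the coordinates `K₀`, all factors first
coordinates, and `K₁ j`, where those of group `j` become last coordinates. Dependence in factor `j`
kills the `j`-th minor; at `firstPoint` and the all-ones point every minor is `1`. -/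
theorem forGeneralPair_linearIndependent {r : ℕ} {n d : Fin r → ℕ} (hn : ∀ j, 0 < n j)
    (hd : ∀ j, 0 < d j) :
    ForGeneralPair (segreVeronese n d) fun p q =>
      ∃ (v w : (j : Fin r) → Fin (n j + 1) → ℂ) (hv : ∀ j, v j ≠ 0) (hw : ∀ j, w j ≠ 0),
        p = segreVeronesePoint n d v hv ∧ q = segreVeronesePoint n d w hw ∧
        ∀ j, LinearIndependent ℂ ![v j, w j] := by
  let K₀ : MonomialIndex n d := monomialOf fun _ => 0
  let K₁ : Fin r → MonomialIndex n d := fun j =>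
    monomialOf fun p => if p.1 = j then Fin.last _ else 0
  let F : MvPolynomial (MonomialIndex n d ⊕ MonomialIndex n d) ℂ := ∏ j,
    (MvPolynomial.X (Sum.inl K₀) * MvPolynomial.X (Sum.inr (K₁ j)) -
      MvPolynomial.X (Sum.inl (K₁ j)) * MvPolynomial.X (Sum.inr K₀))
  refine ⟨F, ⟨segreVeroneseVector n d (firstPoint n), segreVeroneseVector n d fun _ _ => 1,
    segreVeroneseVector_ne_zero n d _ firstPoint_ne_zero,
    segreVeroneseVector_ne_zero n d _ allOnes_ne_zero, ⟨_, firstPoint_ne_zero, rfl⟩,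
    ⟨_, allOnes_ne_zero, rfl⟩, ?_⟩, ?_⟩
  · simp only [F, map_prod, map_sub, map_mul, MvPolynomial.eval_X, Sum.elim_inl, Sum.elim_inr]
    refine Finset.prod_ne_zero_iff.mpr fun j _ => ?_
    have h1 : segreVeroneseVector n d (firstPoint n) (K₁ j) = 0 := by
      rw [segreVeroneseVector_monomialOf]
      refine Finset.prod_eq_zero (Finset.mem_univ (⟨j, ⟨0, hd j⟩⟩ : Σ j, Fin (d j))) ?_
      have := fin_last_ne_zero (hn j)
      simp [firstPoint, this]
    rw [h1, zero_mul, sub_zero]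
    simp [K₀, K₁, segreVeroneseVector_monomialOf, firstPoint]
  · rintro v' w' hv' hw' ⟨v, hv, hvv⟩ ⟨w, hw, hww⟩ hF
    refine ⟨v, w, hv, hw, hvv, hww, fun j => ?_⟩
    by_contra hj
    obtain ⟨a, rfl⟩ := (Projectivization.mk_eq_mk_iff' ℂ _ _ _ _).mp hvv
    obtain ⟨b, rfl⟩ := (Projectivization.mk_eq_mk_iff' ℂ _ _ _ _).mp hww
    refine hF ?_
    simp only [F, map_prod, map_sub, map_mul, MvPolynomial.eval_X, Sum.elim_inl, Sum.elim_inr]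
    refine Finset.prod_eq_zero (Finset.mem_univ j) ?_
    have h1 : segreVeroneseVector n d v K₀ * segreVeroneseVector n d w (K₁ j) =
        segreVeroneseVector n d v (K₁ j) * segreVeroneseVector n d w K₀ := by
      simp only [K₀, K₁, segreVeroneseVector_monomialOf, ← Finset.prod_mul_distrib]
      refine Finset.prod_congr rfl fun p _ => ?_
      split_ifs with hp
      · obtain ⟨i, _⟩ := p
        subst hp
        exact cross_eq_of_not_linearIndependent hj _ _
      · rfl
    simp only [Pi.smul_apply, smul_eq_mul]
    linear_combination a * b * h1

/-- In each factor, the independent vectors `(1, 0, …, 0)` and `(0, 1, …, 1)` can be sent to any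
independent pair by a linear automorphism. -/
theorem forGeneralPair_segreVeroneseCurve {r : ℕ} {n d : Fin r → ℕ} (hn : ∀ j, 0 < n j)
    (hd : ∀ j, 0 < d j) :
    ForGeneralPair (segreVeronese n d) fun p q =>
      ∃ g : (j : Fin r) → (Fin (n j + 1) → ℂ) ≃ₗ[ℂ] (Fin (n j + 1) → ℂ),
        segreVeroneseCurve g d hn lineOrigin = p ∧ segreVeroneseCurve g d hn lineInfinity = q := by
  refine (forGeneralPair_linearIndependent hn hd).mono ?_
  rintro p q ⟨v, w, hv, hw, rfl, rfl, h⟩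
  have hstd : ∀ j, LinearIndependent ℂ ![standardLine n ![1, 0] j, standardLine n ![0, 1] j] := by
    intro j
    by_contra hj
    have h1 := cross_eq_of_not_linearIndependent hj 0 (Fin.last _)
    have := fin_last_ne_zero (hn j)
    simp [standardLine, this] at h1
  choose g hg hg' using fun j => (hstd j).exists_linearEquiv_pair (h j)
  refine ⟨g, ?_, ?_⟩
  · rw [lineOrigin, segreVeroneseCurve_mk]
    exact segreVeronesePoint_eq_of_smul _ _ 1 fun j => by rw [hg, one_smul]
  · rw [lineInfinity, segreVeroneseCurve_mk]
    exact segreVeronesePoint_eq_of_smul _ _ 1 fun j => by rw [hg', one_smul]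

theorem mainTheorem3 (r : ℕ) (hr : 0 < r) (n d : Fin r → ℕ)
    (hn : ∀ j, 0 < n j) (hd : ∀ j, 0 < d j) :
    HasStrongTwoOsculatingRegularity (segreVeronese n d) ∧
    ForGeneralPair (segreVeronese n d) (fun p q => ∀ k₁ k₂ : ℕ,
      ∃ γ : ℙ ℂ (Fin 2 → ℂ) → ℙ ℂ (MonomialIndex n d → ℂ),
        IsRationalNormalCurve (∑ j, d j) γ ∧ (∀ t, γ t ∈ segreVeronese n d) ∧
        ∃ t₀ t₁ : ℙ ℂ (Fin 2 → ℂ), γ t₀ = p ∧ γ t₁ = q ∧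
          LimitInOsculatingSpace (M := 1) (segreVeronese n d) p k₁ k₂ Set.univ γ t₀) := by
  have hmem : ∀ (g : (j : Fin r) → (Fin (n j + 1) → ℂ) ≃ₗ[ℂ] (Fin (n j + 1) → ℂ)) t,
      segreVeroneseCurve g d hn t ∈ segreVeronese n d := fun g t =>
    ⟨_, apply_standardLine_ne_zero g hn t.rep_nonzero, rfl⟩
  constructor
  · refine (forGeneralPair_segreVeroneseCurve hn hd).mono ?_
    rintro p q ⟨g, rfl, rfl⟩ k₁ k₂
    exact ⟨1, Set.univ, segreVeroneseCurve g d hn, isSmoothCurve_projectiveLine,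
      isMorphismOn_segreVeroneseCurve g hn, fun t _ => hmem g t, lineOrigin, trivial,
      lineInfinity, trivial, rfl, rfl, limitInOsculatingSpace_segreVeroneseCurve g hn hd k₁ k₂⟩
  · refine (forGeneralPair_segreVeroneseCurve hn hd).mono ?_
    rintro p q ⟨g, rfl, rfl⟩ k₁ k₂
    exact ⟨segreVeroneseCurve g d hn, isRationalNormalCurve_segreVeroneseCurve g hn, hmem g,
      lineOrigin, lineInfinity, rfl, rfl, limitInOsculatingSpace_segreVeroneseCurve g hn hd k₁ k₂⟩
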